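/- Let $X$ and $Y$ be sets of $n\ge 1$ real numbers each, and call $X\times Y$ an $n\times n$ grid. A *convex chain* of size $k$ is a sequence $(x_1,y_1),\dots,(x_k,y_k)$ of points that are the vertices, in clockwise order, of a convex polygon (all internal angles strictly smaller than $\pi$), such that each of the sequences $(x_i)$ and $(y_i)$ is strictly monotonic (increasing or decreasing); sequences of one or two points with strictly monotonic coordinates are also admitted. The grid *supports* the chain if all its vertices lie in $X\times Y$ and no two of them share an $x$- or a $y$-coordinate. The model of computation is the real RAM: exact real arithmetic ($+,-,\times,\div$) and comparisons of real numbers at unit cost, no rounding, and integers that are machine words of $O(\log n)$ bits; time is the number of elementary operations, space the number of memory cells (for integers and for reals). The input consists of $n$ and the elements of $X$ and of $Y$, listed in arbitrary order. Then: 1. There is an algorithm that, given any $n\times n$ grid, computes the maximum size of a supported convex chain in $O(n^4)$ time and $O(n^2)$ space. 2. There is an algorithm that, given any $n\times n$ grid, computes a supported convex chain of maximum size (its vertices listed in clockwise order) in $O(n^4\log n)$ time and $O(n^2\log n)$ space. -/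

import Mathlib

open Asymptotics Filter

namespace GridChain

/-! ### Convex chains in a grid -/

/-- Twice the signed area of the triangle `p q r`; it is negative exactly when `p, q, r` are
the vertices of a nondegenerate triangle in clockwise order. -/
def orient (p q r : ℝ × ℝ) : ℝ :=
  (q.1 - p.1) * (r.2 - p.2) - (q.2 - p.2) * (r.1 - p.1)

/-- `P 0, …, P (k-1)` are the vertices of a convex polygon (all internal angles strictly smaller
than `π`), in clockwise order: any three of them, in the order of the list, form a nondegenerate
clockwise triangle. Sequences of at most two points count as (degenerate) polygons. -/
def IsConvexPolygon {k : ℕ} (P : Fin k → ℝ × ℝ) : Prop :=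
  ∀ ⦃i j l : Fin k⦄, i < j → j < l → orient (P i) (P j) (P l) < 0

/-- A convex chain is a convex polygon, given by its vertices in clockwise order, along which both
the `x`- and the `y`-coordinates are strictly monotonic. (The four combinations of increasing and
decreasing coordinates are the four types of convex chains.) -/
structure IsConvexChain {k : ℕ} (P : Fin k → ℝ × ℝ) : Prop where
  convex : IsConvexPolygon P
  x_mono : StrictMono (fun i => (P i).1) ∨ StrictAnti (fun i => (P i).1)
  y_mono : StrictMono (fun i => (P i).2) ∨ StrictAnti (fun i => (P i).2)

/-- The grid `X × Y` supports `P`: every vertex lies in `X × Y`, and no two vertices share an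
`x`- or a `y`-coordinate. -/
structure Supports (X Y : Set ℝ) {k : ℕ} (P : Fin k → ℝ × ℝ) : Prop where
  mem : ∀ i, P i ∈ X ×ˢ Y
  x_inj : Function.Injective (fun i => (P i).1)
  y_inj : Function.Injective (fun i => (P i).2)

/-- `k` is the maximum size of a convex chain supported by `X × Y`. -/
def IsMaxChainSize (X Y : Set ℝ) (k : ℕ) : Prop :=
  IsGreatest {m : ℕ | ∃ P : Fin m → ℝ × ℝ, IsConvexChain P ∧ Supports X Y P} k

/-! ### The real RAM

A program works on finitely many integer and real registers (those it names) and on two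
arrays of memory cells, one for natural numbers and one for real numbers. Cells are addressed by
integer expressions. There is no conversion between reals and integers (in particular no floor
function): reals influence integers and the control flow only through comparisons. -/

/-- Contents of the registers and of the memory. -/
structure State where
  ireg : ℕ → ℕ
  rreg : ℕ → ℝ
  imem : ℕ → ℕ
  rmem : ℕ → ℝ

/-- The resources of a machine: each of the two memories has `cells` cells (with addresses
`0, …, cells - 1`), and integers are machine words with values at most `word`. -/
structure Limits where
  cells : ℕ
  word : ℕ

/-- Integer expressions. -/
inductive IExpr where
  | const (c : ℕ)
  | reg (r : ℕ)
  | mem (a : IExpr)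
  | add (a b : IExpr)
  | sub (a b : IExpr)
  | mul (a b : IExpr)
  | div (a b : IExpr)

/-- A result that does not fit into a machine word is a fault. -/
def toWord (L : Limits) (v : ℕ) : Option ℕ := if v ≤ L.word then some v else none

/-- Evaluation of an integer expression; `none` is a fault (address out of range, overflow,
division by zero). Subtraction is truncated at `0`, division is integer division. -/
def IExpr.eval (L : Limits) (s : State) : IExpr → Option ℕ
  | const c => toWord L c
  | reg r => some (s.ireg r)
  | mem a => (a.eval L s).bind fun i => if i < L.cells then some (s.imem i) else none
  | add a b => (a.eval L s).bind fun u => (b.eval L s).bind fun v => toWord L (u + v)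
  | sub a b => (a.eval L s).bind fun u => (b.eval L s).bind fun v => toWord L (u - v)
  | mul a b => (a.eval L s).bind fun u => (b.eval L s).bind fun v => toWord L (u * v)
  | div a b => (a.eval L s).bind fun u => (b.eval L s).bind fun v =>
      if v = 0 then none else toWord L (u / v)

/-- Number of elementary operations of an integer expression. -/
def IExpr.cost : IExpr → ℕ
  | const _ => 1
  | reg _ => 1
  | mem a => a.cost + 1
  | add a b => a.cost + b.cost + 1
  | sub a b => a.cost + b.cost + 1
  | mul a b => a.cost + b.cost + 1
  | div a b => a.cost + b.cost + 1

/-- Real expressions: exact arithmetic, rational constants. -/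
inductive RExpr where
  | const (q : ℚ)
  | reg (r : ℕ)
  | mem (a : IExpr)
  | add (a b : RExpr)
  | sub (a b : RExpr)
  | mul (a b : RExpr)
  | div (a b : RExpr)

open Classical in
/-- Evaluation of a real expression; `none` is a fault (address out of range, fault in an address,
division by zero). -/
noncomputable def RExpr.eval (L : Limits) (s : State) : RExpr → Option ℝ
  | const q => some (q : ℝ)
  | reg r => some (s.rreg r)
  | mem a => (a.eval L s).bind fun i => if i < L.cells then some (s.rmem i) else none
  | add a b => (a.eval L s).bind fun u => (b.eval L s).bind fun v => some (u + v)
  | sub a b => (a.eval L s).bind fun u => (b.eval L s).bind fun v => some (u - v)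
  | mul a b => (a.eval L s).bind fun u => (b.eval L s).bind fun v => some (u * v)
  | div a b => (a.eval L s).bind fun u => (b.eval L s).bind fun v =>
      if v = 0 then none else some (u / v)

/-- Number of elementary operations of a real expression. -/
def RExpr.cost : RExpr → ℕ
  | const _ => 1
  | reg _ => 1
  | mem a => a.cost + 1
  | add a b => a.cost + b.cost + 1
  | sub a b => a.cost + b.cost + 1
  | mul a b => a.cost + b.cost + 1
  | div a b => a.cost + b.cost + 1

/-- Tests. -/
inductive Test where
  | ilt (a b : IExpr)
  | ieq (a b : IExpr)
  | rlt (a b : RExpr)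
  | neg (c : Test)
  | conj (c d : Test)

open Classical in
/-- Evaluation of a test; `none` is a fault. The second part of a conjunction is evaluated only if
the first one holds. -/
noncomputable def Test.eval (L : Limits) (s : State) : Test → Option Bool
  | ilt a b => (a.eval L s).bind fun u => (b.eval L s).bind fun v => some (decide (u < v))
  | ieq a b => (a.eval L s).bind fun u => (b.eval L s).bind fun v => some (decide (u = v))
  | rlt a b => (a.eval L s).bind fun u => (b.eval L s).bind fun v => some (decide (u < v))
  | neg c => (c.eval L s).bind fun u => some (!u)
  | conj c d => (c.eval L s).bind fun u => if u = true then d.eval L s else some false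

/-- Number of elementary operations of a test (both parts of a conjunction are charged). -/
def Test.cost : Test → ℕ
  | ilt a b => a.cost + b.cost + 1
  | ieq a b => a.cost + b.cost + 1
  | rlt a b => a.cost + b.cost + 1
  | neg c => c.cost + 1
  | conj c d => c.cost + d.cost + 1

/-- Programs. -/
inductive Prog where
  | skip
  /-- integer register `r` := `e` -/
  | setIReg (r : ℕ) (e : IExpr)
  /-- real register `r` := `e` -/
  | setRReg (r : ℕ) (e : RExpr)
  /-- integer memory cell at address `a` := `e` -/
  | setIMem (a e : IExpr)
  /-- real memory cell at address `a` := `e` -/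
  | setRMem (a : IExpr) (e : RExpr)
  | seq (p q : Prog)
  | ite (c : Test) (p q : Prog)
  | while (c : Test) (p : Prog)

/-- `Exec L p s t s'`: on a machine with resources `L`, the program `p` started in the state `s`
halts, without a fault, in the state `s'` after exactly `t` elementary steps. -/
inductive Exec (L : Limits) : Prog → State → ℕ → State → Prop where
  | skip (s : State) : Exec L .skip s 1 s
  | setIReg {s : State} {r : ℕ} {e : IExpr} {v : ℕ} (he : e.eval L s = some v) :
      Exec L (.setIReg r e) s (e.cost + 1) { s with ireg := Function.update s.ireg r v }
  | setRReg {s : State} {r : ℕ} {e : RExpr} {v : ℝ} (he : e.eval L s = some v) :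
      Exec L (.setRReg r e) s (e.cost + 1) { s with rreg := Function.update s.rreg r v }
  | setIMem {s : State} {a e : IExpr} {i v : ℕ} (ha : a.eval L s = some i) (hi : i < L.cells)
      (he : e.eval L s = some v) :
      Exec L (.setIMem a e) s (a.cost + e.cost + 1)
        { s with imem := Function.update s.imem i v }
  | setRMem {s : State} {a : IExpr} {e : RExpr} {i : ℕ} {v : ℝ} (ha : a.eval L s = some i)
      (hi : i < L.cells) (he : e.eval L s = some v) :
      Exec L (.setRMem a e) s (a.cost + e.cost + 1)
        { s with rmem := Function.update s.rmem i v }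
  | seq {s s₁ s₂ : State} {p q : Prog} {t₁ t₂ : ℕ} (hp : Exec L p s t₁ s₁)
      (hq : Exec L q s₁ t₂ s₂) : Exec L (.seq p q) s (t₁ + t₂) s₂
  | ite_true {s s₁ : State} {c : Test} {p q : Prog} {t : ℕ} (hc : c.eval L s = some true)
      (hp : Exec L p s t s₁) : Exec L (.ite c p q) s (c.cost + 1 + t) s₁
  | ite_false {s s₁ : State} {c : Test} {p q : Prog} {t : ℕ} (hc : c.eval L s = some false)
      (hq : Exec L q s t s₁) : Exec L (.ite c p q) s (c.cost + 1 + t) s₁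
  | while_false {s : State} {c : Test} {p : Prog} (hc : c.eval L s = some false) :
      Exec L (.while c p) s (c.cost + 1) s
  | while_true {s s₁ s₂ : State} {c : Test} {p : Prog} {t₁ t₂ : ℕ}
      (hc : c.eval L s = some true) (hp : Exec L p s t₁ s₁)
      (hw : Exec L (.while c p) s₁ t₂ s₂) :
      Exec L (.while c p) s (c.cost + 1 + t₁ + t₂) s₂

/-! ### Input and output -/

/-- The initial state for the grid `{X 0, …, X (n-1)} × {Y 0, …, Y (n-1)}`: integer register `0`
holds `n`, the real memory starts with `X 0, …, X (n-1), Y 0, …, Y (n-1)` (in the given, arbitrary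
order), and everything else is `0`. -/
def gridInput {n : ℕ} (X Y : Fin n → ℝ) : State where
  ireg := Function.update (fun _ => 0) 0 n
  rreg := fun _ => 0
  imem := fun _ => 0
  rmem := fun i =>
    if h : i < n then X ⟨i, h⟩ else if h' : i - n < n then Y ⟨i - n, h'⟩ else 0

/-- The program `p` runs within time `T`, space `S` and word range `W` (functions of `n`) on all
`n × n` grids, and the final state satisfies `Out`. -/
def SolvesGrid (p : Prog) (T S W : ℕ → ℕ)
    (Out : Set ℝ → Set ℝ → Limits → State → Prop) : Prop :=
  ∀ n : ℕ, 1 ≤ n → ∀ X Y : Fin n → ℝ, Function.Injective X → Function.Injective Y →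
    ∃ (t : ℕ) (s : State), Exec ⟨S n, W n⟩ p (gridInput X Y) t s ∧ t ≤ T n ∧
      Out (Set.range X) (Set.range Y) ⟨S n, W n⟩ s

/-- Integer register `0` contains the maximum size of a supported convex chain. -/
def ReturnsMaxSize (X Y : Set ℝ) (_ : Limits) (s : State) : Prop :=
  IsMaxChainSize X Y (s.ireg 0)

/-- Integer register `0` contains the size `k` of a maximum supported convex chain, and the first
`2 k` cells of the real memory contain the coordinates `x₀, y₀, x₁, y₁, …` of the vertices of such
a chain, in clockwise order. -/
def ReturnsMaxChain (X Y : Set ℝ) (L : Limits) (s : State) : Prop :=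
  IsMaxChainSize X Y (s.ireg 0) ∧ 2 * s.ireg 0 ≤ L.cells ∧
    ∃ P : Fin (s.ireg 0) → ℝ × ℝ, IsConvexChain P ∧ Supports X Y P ∧
      ∀ i : Fin (s.ireg 0), s.rmem (2 * i) = (P i).1 ∧ s.rmem (2 * i + 1) = (P i).2

end GridChain

namespace GridChain

/-! A rotation by a right angle preserves orientation and permutes the four types of chains. It
therefore suffices to find longest chains with both coordinates increasing in four successively
rotated grids (`le_of_incBound`); after four rotations the grid is the original one again.

For increasing coordinates, clockwise convexity means that the slopes of consecutive edges decrease,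
and consecutive triples are enough to check (`orient_neg_of_slopes`). Hence, among the increasing
`k`-point chains that end in a given grid point, one with the steepest last edge can be extended by
every point that extends any of the others. One slope per grid point, the table `lev k`, carries all
that the dynamic program needs: a chain of `k` points makes table `k` nonempty
(`exists_lev_ne_zero`), and an entry can be traced back to a chain (`chainOf_spec`). The maximum
size is the number of the last nonempty table, which is at most `n` since a chain uses each column
at most once.

There are `n ^ 4` pairs of points, yet the next table costs only cubic time. For a fixed pair of
columns, a source point whose edge to some target row is too steep is too steep for all higher
target rows, and among the admissible source rows the lowest gives the steepest edge. Two pointers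
that only move upwards thus settle a pair of columns in linear time (`ends_mergeBody`,
`ends_merge`). The `n` tables take `O(n ^ 4)` time, and only two of them are stored at once.

Keeping all predecessors of all tables would cost cubic space. Instead, ties are broken by index, so
that the best chain into a point is uniquely determined and can be recomputed. In a pass with
distance `h`, every entry carries along the vertex of its best chain in the last table whose number
is a multiple of `h`; from the vertices with numbers divisible by `2h` this yields those divisible
by `h` (`ends_ancPass`). Starting with a power of two above `n` and halving, about `log n` passes
find all vertices, in `O(n ^ 4 log n)` time and in fact in `O(n ^ 2)` space.

Correctness and running time of the programs are proved together by a program logic for `Ends`: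
weakest preconditions for code without loops, invariants with a decreasing measure for loops, and
syntactic frames for everything left untouched. -/

/-! ### Program logic -/

/-- The value of an integer expression that does not fault. -/
def IExpr.val (s : State) : IExpr → ℕ
  | const c => c
  | reg r => s.ireg r
  | mem a => s.imem (a.val s)
  | add a b => a.val s + b.val s
  | sub a b => a.val s - b.val s
  | mul a b => a.val s * b.val s
  | div a b => a.val s / b.val s

/-- An integer expression does not fault. -/
def IExpr.Safe (L : Limits) (s : State) : IExpr → Prop
  | const c => c ≤ L.word
  | reg _ => True
  | mem a => a.Safe L s ∧ a.val s < L.cells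
  | add a b => a.Safe L s ∧ b.Safe L s ∧ a.val s + b.val s ≤ L.word
  | sub a b => a.Safe L s ∧ b.Safe L s ∧ a.val s - b.val s ≤ L.word
  | mul a b => a.Safe L s ∧ b.Safe L s ∧ a.val s * b.val s ≤ L.word
  | div a b => a.Safe L s ∧ b.Safe L s ∧ b.val s ≠ 0 ∧ a.val s / b.val s ≤ L.word

theorem IExpr.eval_eq {L : Limits} {s : State} {e : IExpr} (h : e.Safe L s) :
    e.eval L s = some (e.val s) := by
  induction e with
  | const c => simpa [IExpr.eval, IExpr.val, toWord, IExpr.Safe] using h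
  | reg r => rfl
  | mem a ih => simp [IExpr.eval, IExpr.val, ih h.1, h.2]
  | add a b iha ihb => simp [IExpr.eval, IExpr.val, iha h.1, ihb h.2.1, toWord, h.2.2]
  | sub a b iha ihb =>
    have := h.2.2
    simp [IExpr.eval, IExpr.val, iha h.1, ihb h.2.1, toWord]; omega
  | mul a b iha ihb => simp [IExpr.eval, IExpr.val, iha h.1, ihb h.2.1, toWord, h.2.2]
  | div a b iha ihb =>
    simp [IExpr.eval, IExpr.val, iha h.1, ihb h.2.1, toWord, h.2.2.1, h.2.2.2]

/-- The value of a real expression that does not fault. -/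
noncomputable def RExpr.val (s : State) : RExpr → ℝ
  | const q => q
  | reg r => s.rreg r
  | mem a => s.rmem (a.val s)
  | add a b => a.val s + b.val s
  | sub a b => a.val s - b.val s
  | mul a b => a.val s * b.val s
  | div a b => a.val s / b.val s

/-- A real expression does not fault. -/
def RExpr.Safe (L : Limits) (s : State) : RExpr → Prop
  | const _ => True
  | reg _ => True
  | mem a => a.Safe L s ∧ a.val s < L.cells
  | add a b => a.Safe L s ∧ b.Safe L s
  | sub a b => a.Safe L s ∧ b.Safe L s
  | mul a b => a.Safe L s ∧ b.Safe L s
  | div a b => a.Safe L s ∧ b.Safe L s ∧ b.val s ≠ 0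

theorem RExpr.eval_eq {L : Limits} {s : State} {e : RExpr} (h : e.Safe L s) :
    e.eval L s = some (e.val s) := by
  induction e with
  | const c => rfl
  | reg r => rfl
  | mem a => simp [RExpr.eval, RExpr.val, IExpr.eval_eq h.1, h.2]
  | add a b iha ihb => simp [RExpr.eval, RExpr.val, iha h.1, ihb h.2]
  | sub a b iha ihb => simp [RExpr.eval, RExpr.val, iha h.1, ihb h.2]
  | mul a b iha ihb => simp [RExpr.eval, RExpr.val, iha h.1, ihb h.2]
  | div a b iha ihb => simp [RExpr.eval, RExpr.val, iha h.1, ihb h.2.1, h.2.2]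

/-- The truth of a test that does not fault. -/
def Test.Holds (s : State) : Test → Prop
  | ilt a b => a.val s < b.val s
  | ieq a b => a.val s = b.val s
  | rlt a b => a.val s < b.val s
  | neg c => ¬ c.Holds s
  | conj c d => c.Holds s ∧ d.Holds s

/-- A test does not fault. -/
def Test.Safe (L : Limits) (s : State) : Test → Prop
  | ilt a b => a.Safe L s ∧ b.Safe L s
  | ieq a b => a.Safe L s ∧ b.Safe L s
  | rlt a b => a.Safe L s ∧ b.Safe L s
  | neg c => c.Safe L s
  | conj c d => c.Safe L s ∧ (c.Holds s → d.Safe L s)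

open Classical in
theorem Test.eval_eq {L : Limits} {s : State} {c : Test} (h : c.Safe L s) :
    c.eval L s = some (decide (c.Holds s)) := by
  induction c with
  | ilt a b =>
    simp only [Test.eval, IExpr.eval_eq h.1, IExpr.eval_eq h.2, Option.bind_some]
    congr
  | ieq a b =>
    simp only [Test.eval, IExpr.eval_eq h.1, IExpr.eval_eq h.2, Option.bind_some]
    congr
  | rlt a b =>
    simp only [Test.eval, RExpr.eval_eq h.1, RExpr.eval_eq h.2, Option.bind_some]
    congr
  | neg c ih => by_cases hc : c.Holds s <;> simp [Test.eval, Test.Holds, ih h, hc]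
  | conj c d ihc ihd =>
    by_cases hc : c.Holds s
    · simp [Test.eval, Test.Holds, ihc h.1, ihd (h.2 hc), hc]
    · simp [Test.eval, Test.Holds, ihc h.1, hc]

theorem Test.eval_true {L : Limits} {s : State} {c : Test} (h : c.Safe L s) (hc : c.Holds s) :
    c.eval L s = some true := by simp [Test.eval_eq h, hc]

theorem Test.eval_false {L : Limits} {s : State} {c : Test} (h : c.Safe L s)
    (hc : ¬ c.Holds s) : c.eval L s = some false := by simp [Test.eval_eq h, hc]

/-- Started in `s`, the program `p` halts without a fault after at most `T` steps, in a state
that satisfies `Q`. -/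
def Ends (L : Limits) (p : Prog) (s : State) (T : ℕ) (Q : State → Prop) : Prop :=
  ∃ t s', Exec L p s t s' ∧ t ≤ T ∧ Q s'

theorem Ends.mono {L : Limits} {p : Prog} {s : State} {T T' : ℕ} {Q Q' : State → Prop}
    (h : Ends L p s T Q) (hT : T ≤ T') (hQ : ∀ s', Q s' → Q' s') : Ends L p s T' Q' := by
  obtain ⟨t, s', he, ht, hq⟩ := h
  exact ⟨t, s', he, ht.trans hT, hQ _ hq⟩

theorem Ends.seq {L : Limits} {p q : Prog} {s : State} {T T' : ℕ} {Q : State → Prop}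
    (h : Ends L p s T (fun s₁ => Ends L q s₁ T' Q)) : Ends L (.seq p q) s (T + T') Q := by
  obtain ⟨t, s₁, he, ht, t', s', he', ht', hq⟩ := h
  exact ⟨t + t', s', .seq he he', by omega, hq⟩

theorem Ends.ite {L : Limits} {c : Test} {p q : Prog} {s : State} {T : ℕ} {Q : State → Prop}
    (hc : c.Safe L s) (hp : c.Holds s → Ends L p s T Q) (hq : ¬ c.Holds s → Ends L q s T Q) :
    Ends L (.ite c p q) s (c.cost + 1 + T) Q := by
  by_cases h : c.Holds s
  · obtain ⟨t, s', he, ht, hQ⟩ := hp h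
    exact ⟨_, s', .ite_true (Test.eval_true hc h) he, by omega, hQ⟩
  · obtain ⟨t, s', he, ht, hQ⟩ := hq h
    exact ⟨_, s', .ite_false (Test.eval_false hc h) he, by omega, hQ⟩

/-- A loop whose invariant `I m` bounds by `m` the number of iterations left. -/
theorem Ends.while {L : Limits} {c : Test} {p : Prog} {B : ℕ} {I : ℕ → State → Prop}
    {Q : State → Prop} (hc : ∀ m s, I m s → c.Safe L s)
    (hp : ∀ m s, I m s → c.Holds s → Ends L p s B (fun s' => ∃ m' < m, I m' s'))
    (hQ : ∀ m s, I m s → ¬ c.Holds s → Q s) (m : ℕ) (s : State) (h : I m s) :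
    Ends L (.while c p) s (m * (B + c.cost + 1) + c.cost + 1) Q := by
  induction m using Nat.strong_induction_on generalizing s with
  | _ m ih =>
    by_cases hs : c.Holds s
    · obtain ⟨t, s₁, he, ht, m', hm', hI⟩ := hp m s h hs
      obtain ⟨t', s', he', ht', hq⟩ := ih m' hm' s₁ hI
      refine ⟨_, s', .while_true (Test.eval_true (hc m s h) hs) he he', ?_, hq⟩
      have : (m' + 1) * (B + c.cost + 1) ≤ m * (B + c.cost + 1) := Nat.mul_le_mul_right _ hm'
      rw [Nat.add_mul] at this
      omega
    · exact ⟨_, s, .while_false (Test.eval_false (hc m s h) hs), by omega, hQ m s h hs⟩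

/-- Weakest precondition of a program without loops. -/
def Prog.wp (L : Limits) : Prog → (State → Prop) → State → Prop
  | skip, Q, s => Q s
  | setIReg r e, Q, s => e.Safe L s ∧ Q { s with ireg := Function.update s.ireg r (e.val s) }
  | setRReg r e, Q, s => e.Safe L s ∧ Q { s with rreg := Function.update s.rreg r (e.val s) }
  | setIMem a e, Q, s => a.Safe L s ∧ a.val s < L.cells ∧ e.Safe L s ∧
      Q { s with imem := Function.update s.imem (a.val s) (e.val s) }
  | setRMem a e, Q, s => a.Safe L s ∧ a.val s < L.cells ∧ e.Safe L s ∧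
      Q { s with rmem := Function.update s.rmem (a.val s) (e.val s) }
  | seq p q, Q, s => p.wp L (q.wp L Q) s
  | ite c p q, Q, s => c.Safe L s ∧ (c.Holds s → p.wp L Q s) ∧ (¬ c.Holds s → q.wp L Q s)
  | .while _ _, _, _ => False

/-- Running time of a program without loops. -/
def Prog.time : Prog → ℕ
  | skip => 1
  | setIReg _ e => e.cost + 1
  | setRReg _ e => e.cost + 1
  | setIMem a e => a.cost + e.cost + 1
  | setRMem a e => a.cost + e.cost + 1
  | seq p q => p.time + q.time
  | ite c p q => c.cost + 1 + max p.time q.time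
  | .while _ _ => 0

/-- Each conditional is charged its more expensive branch. The precondition of a loop is `False`, so
the value of `Prog.time` on loops never matters. -/
theorem Ends.of_wp {L : Limits} {p : Prog} {s : State} {Q : State → Prop} (h : p.wp L Q s) :
    Ends L p s p.time Q := by
  induction p generalizing s Q with
  | skip => exact ⟨_, _, .skip s, le_rfl, h⟩
  | setIReg r e => exact ⟨_, _, .setIReg (IExpr.eval_eq h.1), le_rfl, h.2⟩
  | setRReg r e => exact ⟨_, _, .setRReg (RExpr.eval_eq h.1), le_rfl, h.2⟩
  | setIMem a e =>
    exact ⟨_, _, .setIMem (IExpr.eval_eq h.1) h.2.1 (IExpr.eval_eq h.2.2.1), le_rfl, h.2.2.2⟩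
  | setRMem a e =>
    exact ⟨_, _, .setRMem (IExpr.eval_eq h.1) h.2.1 (RExpr.eval_eq h.2.2.1), le_rfl, h.2.2.2⟩
  | seq p q ihp ihq => exact Ends.seq ((ihp h).mono le_rfl fun _ => ihq)
  | ite c p q ihp ihq =>
    exact Ends.ite h.1 (fun hc => (ihp (h.2.1 hc)).mono (le_max_left _ _) fun _ => id)
      (fun hc => (ihq (h.2.2 hc)).mono (le_max_right _ _) fun _ => id)
  | _ => exact h.elim

/-! ### What a program leaves unchanged -/

/-- The integer registers that a program may change. -/
def Prog.writes : Prog → List ℕ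
  | setIReg r _ => [r]
  | seq p q => p.writes ++ q.writes
  | ite _ p q => p.writes ++ q.writes
  | .while _ p => p.writes
  | _ => []

/-- The program does not change the real memory. -/
def Prog.keepsRMem : Prog → Bool
  | setRMem _ _ => false
  | seq p q => p.keepsRMem && q.keepsRMem
  | ite _ p q => p.keepsRMem && q.keepsRMem
  | .while _ p => p.keepsRMem
  | _ => true

/-- The program does not change the integer memory. -/
def Prog.keepsIMem : Prog → Bool
  | setIMem _ _ => false
  | seq p q => p.keepsIMem && q.keepsIMem
  | ite _ p q => p.keepsIMem && q.keepsIMem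
  | .while _ p => p.keepsIMem
  | _ => true

/-- `s'` differs from `s` only in what `p` may change. -/
structure Frame (p : Prog) (s s' : State) : Prop where
  ireg : ∀ r, r ∉ p.writes → s'.ireg r = s.ireg r
  rmem : p.keepsRMem = true → s'.rmem = s.rmem
  imem : p.keepsIMem = true → s'.imem = s.imem

theorem Frame.refl (p : Prog) (s : State) : Frame p s s := ⟨by simp, by simp, by simp⟩

theorem Frame.trans {p : Prog} {s s' s'' : State} (h : Frame p s s') (h' : Frame p s' s'') :
    Frame p s s'' :=
  ⟨fun r hr => (h'.ireg r hr).trans (h.ireg r hr), fun hr => (h'.rmem hr).trans (h.rmem hr),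
    fun hr => (h'.imem hr).trans (h.imem hr)⟩

/-- What may change is read off the program text. For concrete programs `decide` settles the
membership questions, and invariants need to mention only what a loop really modifies. -/
theorem Exec.frame {L : Limits} {p : Prog} {s s' : State} {t : ℕ} (h : Exec L p s t s') :
    Frame p s s' := by
  induction h with
  | skip s => exact Frame.refl _ _
  | setIReg he =>
    refine ⟨fun r hr => ?_, by simp, by simp⟩
    simp only [Prog.writes, List.mem_singleton] at hr
    simp [hr]
  | setRReg he => exact ⟨by simp, by simp, by simp⟩
  | setIMem ha hi he => exact ⟨by simp, by simp, by simp [Prog.keepsIMem]⟩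
  | setRMem ha hi he => exact ⟨by simp, by simp [Prog.keepsRMem], by simp⟩
  | seq hp hq ihp ihq =>
    constructor
    · intro r hr
      simp only [Prog.writes, List.mem_append, not_or] at hr
      rw [ihq.ireg r hr.2, ihp.ireg r hr.1]
    · intro hr
      simp only [Prog.keepsRMem, Bool.and_eq_true] at hr
      rw [ihq.rmem hr.2, ihp.rmem hr.1]
    · intro hr
      simp only [Prog.keepsIMem, Bool.and_eq_true] at hr
      rw [ihq.imem hr.2, ihp.imem hr.1]
  | ite_true hc hp ih =>
    constructor
    · intro r hr
      simp only [Prog.writes, List.mem_append, not_or] at hr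
      exact ih.ireg r hr.1
    · intro hr
      simp only [Prog.keepsRMem, Bool.and_eq_true] at hr
      exact ih.rmem hr.1
    · intro hr
      simp only [Prog.keepsIMem, Bool.and_eq_true] at hr
      exact ih.imem hr.1
  | ite_false hc hp ih =>
    constructor
    · intro r hr
      simp only [Prog.writes, List.mem_append, not_or] at hr
      exact ih.ireg r hr.2
    · intro hr
      simp only [Prog.keepsRMem, Bool.and_eq_true] at hr
      exact ih.rmem hr.2
    · intro hr
      simp only [Prog.keepsIMem, Bool.and_eq_true] at hr
      exact ih.imem hr.2
  | while_false hc => exact Frame.refl _ _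
  | while_true hc hp hw ihp ihw =>
    exact Frame.trans ⟨ihp.ireg, ihp.rmem, ihp.imem⟩ ihw

theorem Ends.frame {L : Limits} {p : Prog} {s : State} {T : ℕ} {Q : State → Prop}
    (h : Ends L p s T Q) : Ends L p s T (fun s' => Q s' ∧ Frame p s s') := by
  obtain ⟨t, s', he, ht, hq⟩ := h
  exact ⟨t, s', he, ht, hq, he.frame⟩

theorem Ends.seq_of {L : Limits} {p q : Prog} {s : State} {T T' : ℕ} {R Q : State → Prop}
    (hp : Ends L p s T R) (hq : ∀ s', R s' → Frame p s s' → Ends L q s' T' Q) :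
    Ends L (.seq p q) s (T + T') Q :=
  Ends.seq (hp.frame.mono le_rfl fun s' h => hq s' h.1 h.2)

/-! ### Counting loops -/

/-- Run `body` while register `r`, which is increased by one each time, is below register `b`. -/
def upto (r b : ℕ) (body : Prog) : Prog :=
  .while (.ilt (.reg r) (.reg b)) (.seq body (.setIReg r (.add (.reg r) (.const 1))))

theorem Ends.upto {L : Limits} {r b : ℕ} {body : Prog} {B m : ℕ} {I : ℕ → State → Prop}
    {s₀ : State} {k₀ : ℕ} (hr : r ∉ body.writes) (hb : b ∉ body.writes) (hrb : b ≠ r)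
    (hm : m ≤ L.word) (hk : k₀ ≤ m) (hs : s₀.ireg r = k₀) (hbs : s₀.ireg b = m) (hI : I k₀ s₀)
    (hbody : ∀ k s, k₀ ≤ k → k < m → s.ireg r = k → s.ireg b = m →
      Frame (GridChain.upto r b body) s₀ s → I k s →
      Ends L body s B (fun s' => I (k + 1) { s' with ireg := Function.update s'.ireg r (k + 1) })) :
    Ends L (GridChain.upto r b body) s₀ ((m - k₀) * (B + 8) + 4) (I m) := by
  -- The measure `d` is the number of iterations left, so the counter is `m - d`; `d ≤ m` keeps the
  -- truncated subtraction honest.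
  have key := Ends.while (L := L) (c := .ilt (.reg r) (.reg b))
    (p := .seq body (.setIReg r (.add (.reg r) (.const 1)))) (B := B + 4)
    (I := fun d s => k₀ ≤ m - d ∧ d ≤ m ∧ s.ireg r = m - d ∧ s.ireg b = m ∧
      Frame (GridChain.upto r b body) s₀ s ∧ I (m - d) s) (Q := I m) ?_ ?_ ?_ (m - k₀) s₀ ?_
  · exact key.mono (by simp [Test.cost, IExpr.cost]) fun _ => id
  · intro d s _
    exact ⟨trivial, trivial⟩
  · rintro d s ⟨h1, h2, h3, h4, h5, h6⟩ h7
    simp only [Test.Holds, IExpr.val, h3, h4] at h7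
    refine Ends.seq_of (T := B) (T' := 4) (hbody (m - d) s h1 h7 h3 h4 h5 h6) fun s' h hf => ?_
    have h8 : s'.ireg r = m - d := by rw [hf.ireg r hr, h3]
    have e : m - d + 1 = m - (d - 1) := by omega
    refine (Ends.of_wp (p := .setIReg r (.add (.reg r) (.const 1))) (Q := fun s' => _) ?_).mono
      (by simp [Prog.time, IExpr.cost]) fun _ => id
    refine ⟨⟨trivial, (by show 1 ≤ L.word; omega), ?_⟩, d - 1, by omega, by omega, by omega, ?_,
      ?_, ?_, ?_⟩
    · simp only [IExpr.val, h8]; omega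
    · simp only [IExpr.val, h8]; simp [e]
    · simp [hrb, hf.ireg b hb, h4]
    · refine h5.trans ⟨fun r' hr' => ?_, fun h => ?_, fun h => ?_⟩
      · simp only [GridChain.upto, Prog.writes, List.mem_append, List.mem_singleton,
          not_or] at hr'
        simp [hr'.2, hf.ireg r' hr'.1]
      · simp only [GridChain.upto, Prog.keepsRMem, Bool.and_eq_true] at h
        exact hf.rmem h.1
      · simp only [GridChain.upto, Prog.keepsIMem, Bool.and_eq_true] at h
        exact hf.imem h.1
    · simpa only [IExpr.val, h8, e] using h
  · rintro d s ⟨h1, h2, h3, h4, h5, h6⟩ h7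
    simp only [Test.Holds, IExpr.val, h3, h4] at h7
    have : d = 0 := by omega
    simpa [this] using h6
  · have : m - (m - k₀) = k₀ := by omega
    rw [this]
    exact ⟨le_rfl, by omega, hs, hbs, Frame.refl _ _, hI⟩

/-- Run `body` with register `r` equal to `0, 1, …`, as long as it is below register `b`. -/
def forLoop (r b : ℕ) (body : Prog) : Prog := .seq (.setIReg r (.const 0)) (upto r b body)

theorem Ends.forLoop {L : Limits} {r b : ℕ} {body : Prog} {B m : ℕ} {I : ℕ → State → Prop}
    {s₀ : State} (hr : r ∉ body.writes) (hb : b ∉ body.writes) (hrb : b ≠ r)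
    (hm : m ≤ L.word) (hbs : s₀.ireg b = m)
    (hI : I 0 { s₀ with ireg := Function.update s₀.ireg r 0 })
    (hbody : ∀ k s, k < m → s.ireg r = k → s.ireg b = m →
      Frame (GridChain.forLoop r b body) s₀ s → I k s →
      Ends L body s B (fun s' => I (k + 1) { s' with ireg := Function.update s'.ireg r (k + 1) })) :
    Ends L (GridChain.forLoop r b body) s₀ ((m + 1) * (B + 8)) (I m) := by
  have key : Ends L (GridChain.forLoop r b body) s₀ (2 + ((m - 0) * (B + 8) + 4)) (I m) := by
    refine Ends.seq_of (Ends.of_wp (p := .setIReg r (.const 0))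
      (Q := fun s => s = { s₀ with ireg := Function.update s₀.ireg r 0 })
      ⟨Nat.zero_le _, rfl⟩) ?_
    rintro s rfl -
    refine Ends.upto hr hb hrb hm (Nat.zero_le m) (by simp) (by simp [hrb, hbs]) hI
      fun k s _ h1 h2 h3 h4 h5 => hbody k s h1 h2 h3 ⟨fun r' hr' => ?_, h4.rmem, h4.imem⟩ h5
    rw [h4.ireg r' (fun h => hr' (List.mem_append_right _ h))]
    have : r' ≠ r := fun h => hr' (by simp [h, GridChain.forLoop, Prog.writes])
    simp [this]
  -- The additional summand `B + 8` absorbs the 6 steps for setting the counter and for the last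
  -- test.
  refine key.mono ?_ fun _ => id
  rw [Nat.add_mul, Nat.sub_zero]
  omega

/-! ### Tables of steepest last edges

The grid point with index `i * n + j` is `(x i, y j)`. -/

/-- Slope of the line through the grid points with indices `p` and `q`. -/
noncomputable def slope (n : ℕ) (x y : ℕ → ℝ) (p q : ℕ) : ℝ :=
  (y (q % n) - y (p % n)) / (x (q / n) - x (p / n))

/-- The point `q` extends an increasing chain that ends in `p` with a last edge of slope `σ p`
(where a negative value stands for infinity). -/
def Valid (n : ℕ) (x y : ℕ → ℝ) (σ : ℕ → ℝ) (p q : ℕ) : Prop :=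
  x (p / n) < x (q / n) ∧ p % n < q % n ∧ (σ p < 0 ∨ slope n x y p q < σ p)

/-- Among the points with index below `b` that `q` extends, `p` is the first one for which the new
edge is steepest. -/
def IsBest (n : ℕ) (x y : ℕ → ℝ) (σ : ℕ → ℝ) (b q p : ℕ) : Prop :=
  p < b ∧ Valid n x y σ p q ∧ ∀ p' < b, Valid n x y σ p' q →
    slope n x y p' q < slope n x y p q ∨ slope n x y p' q = slope n x y p q ∧ p ≤ p'

/-- The value `t` is the slope of the best edge into `q` from a point with index below `b`, and `a`
is the value of `α` at the start of this edge; `t = 0` if there is no such edge. -/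
def Entry (n : ℕ) (x y : ℕ → ℝ) (σ : ℕ → ℝ) (α : ℕ → ℕ) (b q : ℕ) (t : ℝ) (a : ℕ) : Prop :=
  (t = 0 ∧ ∀ p < b, ¬ Valid n x y σ p q) ∨
    ∃ p, IsBest n x y σ b q p ∧ t = slope n x y p q ∧ a = α p

open Classical in
/-- The best predecessor of `q`. -/
noncomputable def pred (n : ℕ) (x y : ℕ → ℝ) (σ : ℕ → ℝ) (q : ℕ) : ℕ :=
  if h : ∃ p, IsBest n x y σ (n * n) q p then h.choose else 0

open Classical in
/-- The table for chains with one more point. -/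
noncomputable def nxt (n : ℕ) (x y : ℕ → ℝ) (σ : ℕ → ℝ) (q : ℕ) : ℝ :=
  if ∃ p, IsBest n x y σ (n * n) q p then slope n x y (pred n x y σ q) q else 0

/-- The largest slope of the last edge of an increasing convex chain of `k` points that ends in a
given point; it is `0` if there is none, and `-1` for `k = 1`. -/
noncomputable def lev (n : ℕ) (x y : ℕ → ℝ) : ℕ → ℕ → ℝ
  | 0 => fun _ => -1
  | 1 => fun _ => -1
  | k + 2 => nxt n x y (lev n x y (k + 1))

section
variable {n : ℕ} {x y : ℕ → ℝ} {σ : ℕ → ℝ} {α : ℕ → ℕ}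

theorem lev_succ {k : ℕ} (hk : 1 ≤ k) : lev n x y (k + 1) = nxt n x y (lev n x y k) := by
  obtain ⟨k, rfl⟩ := Nat.exists_eq_add_of_le' hk
  rfl

theorem div_lt_of_lt_sq {p : ℕ} (h : p < n * n) : p / n < n := Nat.div_lt_of_lt_mul h

theorem mod_lt_of_lt_sq {p : ℕ} (h : p < n * n) : p % n < n :=
  Nat.mod_lt _ (Nat.pos_of_ne_zero fun h0 => by simp [h0] at h)

theorem idx_lt {b i j : ℕ} (hi : i < b) (hj : j < n) : i * n + j < b * n := by
  calc i * n + j < (i + 1) * n := by rw [Nat.add_mul]; omega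
    _ ≤ b * n := Nat.mul_le_mul_right _ hi

theorem idx_div {i j : ℕ} (hj : j < n) : (i * n + j) / n = i := by
  rw [Nat.add_comm, Nat.add_mul_div_right _ _ (by omega), Nat.div_eq_of_lt hj, Nat.zero_add]

theorem idx_mod {i j : ℕ} (hj : j < n) : (i * n + j) % n = j := by
  rw [Nat.add_comm, Nat.add_mul_mod_self_right, Nat.mod_eq_of_lt hj]

theorem div_add_mod_eq (p : ℕ) : p / n * n + p % n = p := by
  rw [Nat.mul_comm]; exact Nat.div_add_mod p n

/-- Because slopes of usable edges are positive, `0` is free to mark an absent entry and negative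
numbers are free to stand for infinity. -/
theorem Valid.slope_pos (hy : StrictMonoOn y (Set.Iio n)) {p q : ℕ} (hq : q < n * n)
    (h : Valid n x y σ p q) : 0 < slope n x y p q := by
  have hqn := mod_lt_of_lt_sq hq
  exact div_pos (sub_pos.2 (hy (h.2.1.trans hqn) hqn h.2.1)) (sub_pos.2 h.1)

theorem Valid.ne_zero (hy : StrictMonoOn y (Set.Iio n)) {p q : ℕ} (hq : q < n * n)
    (h : Valid n x y σ p q) : σ p ≠ 0 := by
  have := h.slope_pos hy hq
  rcases h.2.2 with h' | h' <;> intro h0 <;> linarith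

/-- Breaking ties by index is what makes the best predecessor a function of the table; repeated
passes over the tables therefore follow one and the same chain. -/
theorem IsBest.unique {b q p p' : ℕ} (h : IsBest n x y σ b q p) (h' : IsBest n x y σ b q p') :
    p = p' := by
  rcases h.2.2 p' h'.1 h'.2.1 with h1 | h1 <;> rcases h'.2.2 p h.1 h.2.1 with h2 | h2
  · linarith
  · linarith [h2.1]
  · linarith [h1.1]
  · omega

theorem IsBest.exists {b q p : ℕ} (hp : p < b) (h : Valid n x y σ p q) :
    ∃ p, IsBest n x y σ b q p := by
  classical
  obtain ⟨m, hm, hmax⟩ := Finset.exists_max_image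
    ((Finset.range b).filter fun p => Valid n x y σ p q) (fun p => slope n x y p q)
    ⟨p, by simp [hp, h]⟩
  simp only [Finset.mem_filter, Finset.mem_range, and_imp] at hm hmax
  have hex : ∃ p, p < b ∧ Valid n x y σ p q ∧ slope n x y p q = slope n x y m q :=
    ⟨m, hm.1, hm.2, rfl⟩
  obtain ⟨h1, h2, h3⟩ := Nat.find_spec hex
  refine ⟨Nat.find hex, h1, h2, fun p' hp' hv => ?_⟩
  rw [h3]
  rcases (hmax p' hp' hv).lt_or_eq with h4 | h4
  · exact .inl h4
  · exact .inr ⟨h4, Nat.find_min' hex ⟨hp', hv, h4⟩⟩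

theorem IsBest.pred_eq {q p : ℕ} (h : IsBest n x y σ (n * n) q p) : pred n x y σ q = p := by
  have hex : ∃ p, IsBest n x y σ (n * n) q p := ⟨p, h⟩
  rw [pred, dif_pos hex]
  exact hex.choose_spec.unique h

theorem IsBest.nxt_eq {q p : ℕ} (h : IsBest n x y σ (n * n) q p) :
    nxt n x y σ q = slope n x y p q := by
  rw [nxt, if_pos ⟨p, h⟩, h.pred_eq]

theorem Entry.eq_nxt {q a : ℕ} {t : ℝ} (h : Entry n x y σ α (n * n) q t a) :
    t = nxt n x y σ q := by
  rcases h with ⟨rfl, h⟩ | ⟨p, h, rfl, rfl⟩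
  · rw [nxt, if_neg]
    rintro ⟨p, hp⟩
    exact h p hp.1 hp.2.1
  · exact h.nxt_eq.symm

/-- The ancestor of an absent entry is arbitrary, hence the restriction to nonzero entries. -/
theorem Entry.eq_pred {q a : ℕ} {t : ℝ} (h : Entry n x y σ α (n * n) q t a)
    (h0 : nxt n x y σ q ≠ 0) : a = α (pred n x y σ q) := by
  rcases h with ⟨rfl, h⟩ | ⟨p, h, rfl, rfl⟩
  · rw [nxt, if_neg] at h0
    · exact absurd rfl h0
    · rintro ⟨p, hp⟩
      exact h p hp.1 hp.2.1
  · rw [h.pred_eq]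

theorem nxt_ne_zero {q : ℕ} (h : nxt n x y σ q ≠ 0) :
    IsBest n x y σ (n * n) q (pred n x y σ q) := by
  by_cases hex : ∃ p, IsBest n x y σ (n * n) q p
  · obtain ⟨p, hp⟩ := hex
    rwa [hp.pred_eq]
  · exact absurd (by rw [nxt, if_neg hex]) h

theorem Valid.le_nxt {p q : ℕ} (hp : p < n * n) (h : Valid n x y σ p q) :
    slope n x y p q ≤ nxt n x y σ q := by
  obtain ⟨m, hm⟩ := IsBest.exists hp h
  rw [hm.nxt_eq]
  rcases hm.2.2 p hp h with h' | h'
  · exact h'.le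
  · exact h'.1.le

/-- A column without valid predecessors. -/
theorem Entry.skip {i q a : ℕ} {t : ℝ} (h : Entry n x y σ α (i * n) q t a)
    (hv : ∀ j < n, ¬ Valid n x y σ (i * n + j) q) : Entry n x y σ α ((i + 1) * n) q t a := by
  have key : ∀ p < (i + 1) * n, Valid n x y σ p q → p < i * n := by
    intro p hp hp'
    by_contra hc
    refine hv (p - i * n) (by rw [Nat.add_mul] at hp; omega) ?_
    rwa [Nat.add_sub_cancel' (not_lt.1 hc)]
  rcases h with ⟨rfl, h⟩ | ⟨p, h, rfl, rfl⟩
  · exact .inl ⟨rfl, fun p hp hp' => h p (key p hp hp') hp'⟩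
  · exact .inr ⟨p, ⟨h.1.trans_le (by rw [Nat.add_mul]; omega), h.2.1,
      fun p' h1 h2 => h.2.2 p' (key p' h1 h2) h2⟩, rfl, rfl⟩

open Classical in
/-- A column in which the first valid predecessor is `j`. -/
theorem Entry.update (hy : StrictMonoOn y (Set.Iio n)) {i j q a : ℕ} {t : ℝ} (hq : q < n * n)
    (hj : j < n) (h : Entry n x y σ α (i * n) q t a) (hv : Valid n x y σ (i * n + j) q)
    (hv' : ∀ j' < j, ¬ Valid n x y σ (i * n + j') q) :
    Entry n x y σ α ((i + 1) * n) q
      (if t < slope n x y (i * n + j) q then slope n x y (i * n + j) q else t)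
      (if t < slope n x y (i * n + j) q then α (i * n + j) else a) := by
  have hlt : i * n + j < (i + 1) * n := idx_lt (Nat.lt_succ_self i) hj
  -- All points of the column have the same horizontal distance to `q`, so the slope drops as the
  -- row rises: the lowest valid row gives the steepest edge and also has the smallest index.
  have hcol : ∀ p < (i + 1) * n, i * n ≤ p → Valid n x y σ p q →
      i * n + j ≤ p ∧ slope n x y p q ≤ slope n x y (i * n + j) q := by
    intro p hp hp' hpv
    obtain ⟨j', rfl⟩ := Nat.exists_eq_add_of_le hp'
    have hj' : j' < n := by rw [Nat.add_mul] at hp; omega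
    have hjj : j ≤ j' := not_lt.1 fun hc => hv' j' hc hpv
    refine ⟨by omega, ?_⟩
    have hx := hv.1
    rw [idx_div hj] at hx
    simp only [slope, idx_div hj, idx_div hj', idx_mod hj, idx_mod hj']
    have := hy.monotoneOn (show j ∈ Set.Iio n from hj) (show j' ∈ Set.Iio n from hj') hjj
    exact div_le_div_of_nonneg_right (by linarith) (by linarith)
  have hpos := hv.slope_pos hy hq
  split_ifs with ht
  · refine .inr ⟨_, ⟨hlt, hv, fun p hp hpv => ?_⟩, rfl, rfl⟩
    by_cases hpi : i * n ≤ p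
    · obtain ⟨h1, h2⟩ := hcol p hp hpi hpv
      rcases h2.lt_or_eq with h3 | h3
      · exact .inl h3
      · exact .inr ⟨h3, h1⟩
    · rcases h with ⟨rfl, h⟩ | ⟨p', h, rfl, rfl⟩
      · exact absurd hpv (h p (not_le.1 hpi))
      · left
        rcases h.2.2 p (not_le.1 hpi) hpv with h1 | h1
        · exact h1.trans ht
        · exact h1.1.trans_lt ht
  -- The old edge survives a tie, as it should: it starts in an earlier column and so has the
  -- smaller index. An absent entry `0` cannot survive, since the new slope is positive.
  · rcases h with ⟨rfl, h⟩ | ⟨p', h, rfl, rfl⟩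
    · exact absurd hpos ht
    · refine .inr ⟨p', ⟨h.1.trans_le (by rw [Nat.add_mul]; omega), h.2.1, fun p hp hpv => ?_⟩,
        rfl, rfl⟩
      by_cases hpi : i * n ≤ p
      · obtain ⟨h1, h2⟩ := hcol p hp hpi hpv
        rcases (h2.trans (not_lt.1 ht)).lt_or_eq with h3 | h3
        · exact .inl h3
        · exact .inr ⟨h3, (h.1.trans_le hpi).le⟩
      · exact h.2.2 p (not_le.1 hpi) hpv

/-! ### Chains and tables -/

/-- An increasing chain reaches every table. -/
theorem exists_lev_ne_zero (hy : StrictMonoOn y (Set.Iio n)) {m : ℕ} (hm : 1 ≤ m)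
    {P : Fin m → ℝ × ℝ} (hP : IsConvexPolygon P) (hx1 : StrictMono fun i => (P i).1)
    (hy1 : StrictMono fun i => (P i).2)
    (hmem : ∀ i, P i ∈ (x '' Set.Iio n) ×ˢ (y '' Set.Iio n)) :
    ∃ q < n * n, lev n x y m q ≠ 0 := by
  choose a ha hxa using fun i => (hmem i).1
  choose b hb hyb using fun i => (hmem i).2
  have hpd (i) : (a i * n + b i) / n = a i := idx_div (hb i)
  have hpm (i) : (a i * n + b i) % n = b i := idx_mod (hb i)
  have hlt (i) : a i * n + b i < n * n := idx_lt (ha i) (hb i)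
  -- The induction also records that the table value is at least the slope of the chain's own edge
  -- into the vertex. The next edge of the chain is flatter than that edge, hence is admitted by the
  -- table as well.
  have key : ∀ k (hk : k < m), lev n x y (k + 1) (a ⟨k, hk⟩ * n + b ⟨k, hk⟩) ≠ 0 ∧
      ∀ k' (hk' : k' + 1 = k), slope n x y (a ⟨k', by omega⟩ * n + b ⟨k', by omega⟩)
        (a ⟨k, hk⟩ * n + b ⟨k, hk⟩) ≤ lev n x y (k + 1) (a ⟨k, hk⟩ * n + b ⟨k, hk⟩) := by
    intro k
    induction k with
    | zero => exact fun hk => ⟨by simp [lev], fun k' h => by omega⟩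
    | succ k ih =>
      intro hk
      obtain ⟨-, ih2⟩ := ih (by omega)
      have hkk : (⟨k, by omega⟩ : Fin m) < ⟨k + 1, hk⟩ := Fin.mk_lt_mk.2 (by omega)
      have hv : Valid n x y (lev n x y (k + 1)) (a ⟨k, by omega⟩ * n + b ⟨k, by omega⟩)
          (a ⟨k + 1, hk⟩ * n + b ⟨k + 1, hk⟩) := by
        refine ⟨?_, ?_, ?_⟩
        · rw [hpd, hpd, hxa, hxa]
          exact hx1 hkk
        · rw [hpm, hpm, ← hy.lt_iff_lt (hb _) (hb _), hyb, hyb]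
          exact hy1 hkk
        · rcases Nat.eq_zero_or_pos k with rfl | hk0
          · left; simp [lev]
          · right
            obtain ⟨k, rfl⟩ := Nat.exists_eq_add_of_le' hk0
            refine lt_of_lt_of_le ?_ (ih2 k rfl)
            have hkk' : (⟨k, by omega⟩ : Fin m) < ⟨k + 1, by omega⟩ := Fin.mk_lt_mk.2 (by omega)
            have ho := hP hkk' hkk
            have h1 := hx1 hkk
            have h2 := hx1 hkk'
            simp only [slope, hpd, hpm, hxa, hyb, orient] at ho h1 h2 ⊢
            rw [div_lt_div_iff₀ (by linarith) (by linarith)]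
            nlinarith
      have := hv.le_nxt (hlt _)
      have hpos := hv.slope_pos hy (hlt _)
      rw [← lev_succ (by omega)] at this
      refine ⟨by linarith, fun k' hk' => ?_⟩
      obtain rfl : k' = k := by omega
      exact this
  obtain ⟨k, rfl⟩ := Nat.exists_eq_add_of_le' hm
  exact ⟨_, hlt _, (key k (by omega)).1⟩

/-- Distinct vertices lie in distinct columns. This is why `n` tables suffice. -/
theorem card_le_of_mem {m : ℕ} {P : Fin m → ℝ × ℝ} (hx1 : StrictMono fun i => (P i).1)
    (hmem : ∀ i, (P i).1 ∈ x '' Set.Iio n) : m ≤ n := by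
  choose a ha hxa using hmem
  have : Function.Injective fun i => (⟨a i, ha i⟩ : Fin n) := by
    intro i j hij
    refine hx1.injective ?_
    have := congrArg Fin.val hij
    simp only [← hxa]
    exact congrArg x this
  simpa using Fintype.card_le_of_injective _ this

/-- Points with decreasing slopes between neighbours are in convex position. -/
theorem orient_neg_of_slopes {K : ℕ} {a b s : ℕ → ℝ} (ha : ∀ m, m + 1 < K → a m < a (m + 1))
    (hb : ∀ m, m + 1 < K → b (m + 1) - b m = s m * (a (m + 1) - a m))
    (hs : ∀ m, m + 2 < K → s (m + 1) < s m) {i j l : ℕ} (hij : i < j) (hjl : j < l) (hl : l < K) :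
    orient (a i, b i) (a j, b j) (a l, b l) < 0 := by
  have mono : ∀ i d, i + d + 1 < K → a i < a (i + d + 1) := by
    intro i d
    induction d with
    | zero => exact fun h => ha i h
    | succ d ih => exact fun h => (ih (by omega)).trans (ha _ h)
  have anti : ∀ i d, i + d + 1 < K → s (i + d) ≤ s i := by
    intro i d
    induction d with
    | zero => exact fun h => le_rfl
    | succ d ih => exact fun h => (hs (i + d) h).le.trans (ih (by omega))
  -- A chord is at least as steep as the last edge below it.
  have left : ∀ d, i + d + 1 < K → s (i + d) * (a (i + d + 1) - a i) ≤ b (i + d + 1) - b i := by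
    intro d
    induction d with
    | zero => exact fun h => (hb i h).ge
    | succ d ih =>
      intro h
      have h1 := ih (by omega)
      have h2 := hb (i + d + 1) h
      have h3 := hs (i + d) h
      have h4 := mono i d (by omega)
      rw [← Nat.add_assoc]
      nlinarith
  -- A chord is at most as steep as the first edge below it.
  have right : ∀ d, j + d + 1 < K → b (j + d + 1) - b j ≤ s j * (a (j + d + 1) - a j) := by
    intro d
    induction d with
    | zero => exact fun h => (hb j h).le
    | succ d ih =>
      intro h
      have h1 := ih (by omega)
      have h2 := hb (j + d + 1) h
      have h3 := anti j (d + 1) (by omega)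
      have h4 := ha (j + d + 1) h
      rw [← Nat.add_assoc] at h3 ⊢
      nlinarith
  obtain ⟨d, rfl⟩ := Nat.exists_eq_add_of_lt hij
  obtain ⟨e, rfl⟩ := Nat.exists_eq_add_of_lt hjl
  have h1 := left d (by omega)
  have h2 := right e (by omega)
  have h3 := hs (i + d) (by omega)
  have h4 := mono i d (by omega)
  have h5 := mono (i + d + 1) e (by omega)
  simp only [orient]
  have h6 : (a (i + d + 1) - a i) * (b (i + d + 1 + e + 1) - b (i + d + 1)) ≤
      (a (i + d + 1) - a i) * (s (i + d + 1) * (a (i + d + 1 + e + 1) - a (i + d + 1))) :=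
    mul_le_mul_of_nonneg_left h2 (by linarith)
  have h7 := mul_le_mul_of_nonneg_right h1
    (show 0 ≤ a (i + d + 1 + e + 1) - a (i + d + 1) by linarith)
  -- The strict inequality comes from the bend at the middle vertex alone, between the edges that
  -- enter and leave it.
  have h8 : 0 < (s (i + d) - s (i + d + 1)) *
      ((a (i + d + 1) - a i) * (a (i + d + 1 + e + 1) - a (i + d + 1))) :=
    mul_pos (by linarith) (mul_pos (by linarith) (by linarith))
  nlinarith

end

/-! ### Reading a chain off the tables -/

/-- The vertex that is `d` steps before the last vertex `q` of the best chain of `K` points. -/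
noncomputable def back (n : ℕ) (x y : ℕ → ℝ) (K q : ℕ) : ℕ → ℕ
  | 0 => q
  | d + 1 => pred n x y (lev n x y (K - (d + 1))) (back n x y K q d)

/-- Vertex number `m` (counted from `1`) of the best chain of `K` points that ends in `q`. -/
noncomputable def vertex (n : ℕ) (x y : ℕ → ℝ) (K q m : ℕ) : ℕ := back n x y K q (K - m)

section
variable {n : ℕ} {x y : ℕ → ℝ} {K q : ℕ}

theorem vertex_self : vertex n x y K q K = q := by simp [vertex, back]

theorem vertex_eq_pred {m : ℕ} (hm : m < K) :
    vertex n x y K q m = pred n x y (lev n x y m) (vertex n x y K q (m + 1)) := by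
  have h1 : K - m = K - (m + 1) + 1 := by omega
  have h2 : K - (K - (m + 1) + 1) = m := by omega
  rw [vertex, h1, back, h2, vertex]

/-- Downward induction: a nonzero entry has a best predecessor, and a point that can be extended has
itself a nonzero entry in the table before. -/
theorem vertex_spec (hy : StrictMonoOn y (Set.Iio n)) (hq : q < n * n) (h : lev n x y K q ≠ 0)
    {m : ℕ} (hm : 1 ≤ m) (hmK : m ≤ K) :
    vertex n x y K q m < n * n ∧ lev n x y m (vertex n x y K q m) ≠ 0 := by
  obtain ⟨d, rfl⟩ := Nat.exists_eq_add_of_le hmK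
  induction d generalizing m with
  | zero => simpa [vertex_self] using And.intro hq h
  | succ d ih =>
    have e : m + 1 + d = m + (d + 1) := by omega
    have := @ih (m + 1) (by omega) (by rwa [e]) (by omega)
    rw [e, lev_succ hm] at this
    have hb := nxt_ne_zero this.2
    rw [vertex_eq_pred (by omega)]
    exact ⟨hb.1, hb.2.1.ne_zero hy this.1⟩

/-- The table value at a vertex is exactly the slope of the edge into it, so validity of the
following edge says that the slopes decrease. -/
theorem vertex_valid (hy : StrictMonoOn y (Set.Iio n)) (hq : q < n * n) (h : lev n x y K q ≠ 0)
    {m : ℕ} (hm : 1 ≤ m) (hmK : m < K) :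
    Valid n x y (lev n x y m) (vertex n x y K q m) (vertex n x y K q (m + 1)) ∧
      lev n x y (m + 1) (vertex n x y K q (m + 1)) =
        slope n x y (vertex n x y K q m) (vertex n x y K q (m + 1)) := by
  have h1 := (vertex_spec hy hq h (m := m + 1) (by omega) (by omega)).2
  rw [lev_succ hm] at h1 ⊢
  have hb := nxt_ne_zero h1
  rw [vertex_eq_pred hmK]
  exact ⟨hb.2.1, hb.nxt_eq⟩

/-- The points of the best chain of `K` points that ends in `q`. -/
noncomputable def chainOf (n : ℕ) (x y : ℕ → ℝ) (K q : ℕ) (i : Fin K) : ℝ × ℝ :=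
  (x (vertex n x y K q (i + 1) / n), y (vertex n x y K q (i + 1) % n))

theorem strictMono_fin_of_succ {a : ℕ → ℝ} (ha : ∀ m, m + 1 < K → a m < a (m + 1)) :
    StrictMono fun i : Fin K => a i := by
  have mono : ∀ i d, i + d + 1 < K → a i < a (i + d + 1) := by
    intro i d
    induction d with
    | zero => exact fun h => ha i h
    | succ d ih => exact fun h => (ih (by omega)).trans (ha _ h)
  intro i j hij
  obtain ⟨d, hd⟩ := Nat.exists_eq_add_of_lt (show (i : ℕ) < j from hij)
  simp only [hd]
  exact mono _ _ (by omega)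

theorem chainOf_spec (hy : StrictMonoOn y (Set.Iio n)) (hq : q < n * n)
    (h : lev n x y K q ≠ 0) :
    IsConvexChain (chainOf n x y K q) ∧
      Supports (x '' Set.Iio n) (y '' Set.Iio n) (chainOf n x y K q) := by
  set v := vertex n x y K q with hv
  have hval (m) (hm : m + 1 < K) := vertex_valid hy hq h (m := m + 1) (by omega) hm
  have hx1 : ∀ m, m + 1 < K → x (v (m + 1) / n) < x (v (m + 1 + 1) / n) :=
    fun m hm => (hval m hm).1.1
  have hlt : ∀ m, m < K → v (m + 1) % n < n := fun m hm =>
    mod_lt_of_lt_sq (vertex_spec hy hq h (by omega) (by omega)).1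
  have hy1 : ∀ m, m + 1 < K → y (v (m + 1) % n) < y (v (m + 1 + 1) % n) := fun m hm =>
    hy (hlt m (by omega)) (hlt (m + 1) hm) (hval m hm).1.2.1
  have hxm : StrictMono fun i => (chainOf n x y K q i).1 :=
    strictMono_fin_of_succ (a := fun m => x (v (m + 1) / n)) hx1
  have hym : StrictMono fun i => (chainOf n x y K q i).2 :=
    strictMono_fin_of_succ (a := fun m => y (v (m + 1) % n)) hy1
  refine ⟨⟨fun i j l hij hjl => ?_, .inl hxm, .inl hym⟩, ⟨fun i => ⟨?_, ?_⟩, hxm.injective,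
    hym.injective⟩⟩
  · refine orient_neg_of_slopes (K := K) (a := fun m => x (v (m + 1) / n))
      (b := fun m => y (v (m + 1) % n)) (s := fun m => slope n x y (v (m + 1)) (v (m + 1 + 1)))
      hx1 ?_ ?_ (show (i : ℕ) < j from hij) hjl l.2
    · intro m hm
      have := hx1 m hm
      simp only [slope]
      rw [div_mul_cancel₀]
      exact sub_ne_zero.2 this.ne'
    · intro m hm
      have h1 := (hval (m + 1) hm).1
      have h2 := (hval m (by omega))
      -- A vertex that has a predecessor has a positive table value, so the marker for infinity
      -- cannot occur here.
      rcases h1.2.2 with h3 | h3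
      · have := h2.1.slope_pos hy (vertex_spec hy hq h (by omega) (by omega)).1
        rw [h2.2] at h3
        linarith
      · rwa [h2.2] at h3
  · exact ⟨_, div_lt_of_lt_sq (vertex_spec hy hq h (by omega) (by omega)).1, rfl⟩
  · exact ⟨_, hlt i i.2, rfl⟩

end

/-! ### Memory layout

Integer registers: `0` holds `n`, `1` holds `n * n`, `2` the size of the best chain so far, `3` and
`4` the size and the last vertex of the longest increasing chain, `5` the number of the table, `6`
the distance of known vertices, `7` to `10` two columns and two rows, `11` to `13` loop counters,
`14` and `15` the bounds `4` and `n + 1`.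

Real memory: `x`, `y`, a table, the next table, the best chain. Integer memory: ancestors for the
two tables, known vertices. -/

/-- The machine on which all programs run. -/
def lim (n : ℕ) : Limits := ⟨10 * (n * n) + 10 * n + 10, 10 * (n * n) + 10 * n + 10⟩

/-- The index of the grid point in the column and the row that the registers `i` and `j` hold. -/
def idxE (i j : ℕ) : IExpr := .add (.mul (.reg i) (.reg 0)) (.reg j)

def yE (e : IExpr) : IExpr := .add (.reg 0) e
def tabE (e : IExpr) : IExpr := .add (.add (.reg 0) (.reg 0)) e
def newTabE (e : IExpr) : IExpr := .add (.add (.add (.reg 0) (.reg 0)) (.reg 1)) e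
def newAncE (e : IExpr) : IExpr := .add (.reg 1) e

/-- The grid is stored. -/
structure Grid (n : ℕ) (x y : ℕ → ℝ) (s : State) : Prop where
  n_eq : s.ireg 0 = n
  nn_eq : s.ireg 1 = n * n
  x_eq : ∀ i < n, s.rmem i = x i
  y_eq : ∀ j < n, s.rmem (n + j) = y j

/-- The table `σ` and the ancestors `α` are stored. -/
structure Table (n : ℕ) (σ : ℕ → ℝ) (α : ℕ → ℕ) (s : State) : Prop where
  tab : ∀ p < n * n, s.rmem (2 * n + p) = σ p
  anc : ∀ p < n * n, s.imem p = α p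

/-- Nothing but the next table has changed. -/
structure SameOld (n : ℕ) (s s' : State) : Prop where
  rmem : ∀ a, a < 2 * n + n * n ∨ 2 * n + 2 * (n * n) ≤ a → s'.rmem a = s.rmem a
  imem : ∀ a, a < n * n ∨ 2 * (n * n) ≤ a → s'.imem a = s.imem a

theorem SameOld.refl (n : ℕ) (s : State) : SameOld n s s := ⟨fun _ _ => rfl, fun _ _ => rfl⟩

theorem SameOld.trans {n : ℕ} {s s' s'' : State} (h : SameOld n s s') (h' : SameOld n s' s'') :
    SameOld n s s'' :=
  ⟨fun a ha => (h'.rmem a ha).trans (h.rmem a ha), fun a ha => (h'.imem a ha).trans (h.imem a ha)⟩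

theorem SameOld.table {n : ℕ} {s s' : State} {σ : ℕ → ℝ} {α : ℕ → ℕ} (h : SameOld n s s')
    (ht : Table n σ α s) : Table n σ α s' :=
  ⟨fun p hp => (h.rmem _ (.inl (by omega))).trans (ht.tab p hp),
    fun p hp => (h.imem _ (.inl hp)).trans (ht.anc p hp)⟩

theorem SameOld.grid {n : ℕ} {s s' : State} {x y : ℕ → ℝ} (h : SameOld n s s')
    (hg : Grid n x y s) (h0 : s'.ireg 0 = s.ireg 0) (h1 : s'.ireg 1 = s.ireg 1) :
    Grid n x y s' :=
  ⟨h0.trans hg.n_eq, h1.trans hg.nn_eq,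
    fun i hi => (h.rmem _ (.inl (by omega))).trans (hg.x_eq i hi),
    fun i hi => (h.rmem _ (.inl (by
      have := Nat.le_mul_self n
      omega))).trans (hg.y_eq i hi)⟩

/-- In the next table, the entries below `c` take the first `i + 1` columns into account, the others
the first `i` columns. -/
def Entries (n : ℕ) (x y : ℕ → ℝ) (σ : ℕ → ℝ) (α : ℕ → ℕ) (i c : ℕ) (s : State) : Prop :=
  ∀ q < n * n, Entry n x y σ α ((if q < c then i + 1 else i) * n) q
    (s.rmem (2 * n + n * n + q)) (s.imem (n * n + q))

/-! ### The next table -/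

/-- The slope between the points in row `9` of column `7` and row `10` of column `8`. -/
def slopeE : RExpr :=
  .div (.sub (.mem (yE (.reg 10))) (.mem (yE (.reg 9)))) (.sub (.mem (.reg 8)) (.mem (.reg 7)))

/-- Register 9 points to the source row, register 10 to the target row. Tests offer no disjunction,
so "infinite, or steeper than the new edge" is written as a negated conjunction. After a valid pair
the target is settled; after a pair that is too steep the source is of no further use. -/
def mergeBody : Prog :=
  .ite (.ilt (.reg 9) (.reg 10))
    (.ite (.neg (.conj (.neg (.rlt (.mem (tabE (idxE 7 9))) (.const 0)))
        (.neg (.rlt slopeE (.mem (tabE (idxE 7 9)))))))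
      (.seq
        (.ite (.rlt (.mem (newTabE (idxE 8 10))) slopeE)
          (.seq (.setRMem (newTabE (idxE 8 10)) slopeE)
            (.setIMem (newAncE (idxE 8 10)) (.mem (idxE 7 9))))
          .skip)
        (.setIReg 10 (.add (.reg 10) (.const 1))))
      (.setIReg 9 (.add (.reg 9) (.const 1))))
    (.setIReg 10 (.add (.reg 10) (.const 1)))

/-- Finds the best edges from column `7` to column `8`. -/
def merge : Prog :=
  .seq (.seq (.setIReg 9 (.const 0)) (.setIReg 10 (.const 0)))
    (.while (.conj (.ilt (.reg 9) (.reg 0)) (.ilt (.reg 10) (.reg 0))) mergeBody)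

section
variable {n : ℕ} {x y : ℕ → ℝ} {σ : ℕ → ℝ} {α : ℕ → ℕ}

/-- Serves for target rows that the source column cannot reach: no memory cell has to change for
them to count as processed. -/
theorem Entries.skip {i c c' : ℕ} {s : State} (h : Entries n x y σ α i c s) (hc : c ≤ c')
    (hv : ∀ q < n * n, c ≤ q → q < c' → ∀ j < n, ¬ Valid n x y σ (i * n + j) q) :
    Entries n x y σ α i c' s := by
  intro q hq
  have := h q hq
  by_cases h1 : q < c
  · rw [if_pos h1] at this
    rwa [if_pos (h1.trans_le hc)]
  · rw [if_neg h1] at this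
    by_cases h2 : q < c'
    · rw [if_pos h2]
      exact this.skip (hv q hq (not_lt.1 h1) h2)
    · rwa [if_neg h2]

theorem Entries.zero_of_sq {i : ℕ} {s : State} (h : Entries n x y σ α i (n * n) s) :
    Entries n x y σ α (i + 1) 0 s := by
  intro q hq
  have := h q hq
  rw [if_pos hq] at this
  rwa [if_neg (Nat.not_lt_zero q)]

/-- The invariant of the loop in `merge`. -/
def MergeInv (n : ℕ) (x y σ : ℕ → ℝ) (α : ℕ → ℕ) (i i' : ℕ) (s₀ : State) (m : ℕ) (s : State) :
    Prop :=
  ∃ j j', s.ireg 9 = j ∧ s.ireg 10 = j' ∧ j ≤ n ∧ j' ≤ n ∧ m = (n - j) + (n - j') ∧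
    (∀ r, r ≠ 9 → r ≠ 10 → s.ireg r = s₀.ireg r) ∧ SameOld n s₀ s ∧
    Entries n x y σ α i (i' * n + j') s ∧
    ∀ j₀ < j, ∀ j₁, j' ≤ j₁ → j₁ < n → ¬ Valid n x y σ (i * n + j₀) (i' * n + j₁)

/-- By the invariant, source rows below the pointer are useless for all remaining targets. A valid
pair thus has the lowest valid source row, which is the situation of `Entry.update`; an invalid pair
discards either the source (`next`) or the target (`next'`). -/
theorem ends_mergeBody (hy : StrictMonoOn y (Set.Iio n)) {i i' m : ℕ} {s₀ s : State}
    (hg : Grid n x y s₀) (ht : Table n σ α s₀) (hi : i < n) (hi' : i' < n)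
    (h7 : s₀.ireg 7 = i) (h8 : s₀.ireg 8 = i') (hx : x i < x i')
    (h : MergeInv n x y σ α i i' s₀ m s) (h9 : s.ireg 9 < n) (h10 : s.ireg 10 < n) :
    Ends (lim n) mergeBody s mergeBody.time
      (fun s' => ∃ m' < m, MergeInv n x y σ α i i' s₀ m' s') := by
  obtain ⟨j, j', e9, e10, -, -, rfl, hr, hs, hE, hv⟩ := h
  rw [e9] at h9
  rw [e10] at h10
  have hp := idx_lt hi h9
  have hq := idx_lt hi' h10
  have hn := Nat.le_mul_self n
  have hg' := hs.grid hg (hr 0 (by simp) (by simp)) (hr 1 (by simp) (by simp))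
  have ht' := hs.table ht
  have e0 := hg'.n_eq
  have e1 := hg'.nn_eq
  have e7 := (hr 7 (by simp) (by simp)).trans h7
  have e8 := (hr 8 (by simp) (by simp)).trans h8
  have hxi := hg'.x_eq i hi
  have hxi' := hg'.x_eq i' hi'
  have hyj := hg'.y_eq j h9
  have hyj' := hg'.y_eq j' h10
  have hσ := ht'.tab _ hp
  have hα := ht'.anc _ hp
  have two : n + n = 2 * n := by omega
  have hslope : (y j' - y j) / (x i' - x i) = slope n x y (i * n + j) (i' * n + j') := by
    simp only [slope, idx_div h9, idx_div h10, idx_mod h9, idx_mod h10]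
  have hx0 : x i' - x i ≠ 0 := by linarith
  have hvalid : Valid n x y σ (i * n + j) (i' * n + j') ↔
      j < j' ∧ (σ (i * n + j) < 0 ∨ slope n x y (i * n + j) (i' * n + j') < σ (i * n + j)) := by
    simp only [Valid, idx_div h9, idx_div h10, idx_mod h9, idx_mod h10, hx, true_and]
  -- From a fixed source the slope grows with the target row: what is too steep for `j'` is too
  -- steep for every row above it, so the source pointer never has to return.
  have hmono : ∀ j₁, j' ≤ j₁ → j₁ < n → Valid n x y σ (i * n + j) (i' * n + j₁) → j < j' →
      Valid n x y σ (i * n + j) (i' * n + j') := by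
    intro j₁ h1 h2 h3 h4
    refine hvalid.2 ⟨h4, h3.2.2.imp id fun h5 => lt_of_le_of_lt ?_ h5⟩
    simp only [slope, idx_div h9, idx_div h10, idx_div h2, idx_mod h9, idx_mod h10, idx_mod h2]
    have := hy.monotoneOn (show j' ∈ Set.Iio n from h10) (show j₁ ∈ Set.Iio n from h2) h1
    exact div_le_div_of_nonneg_right (by linarith) (by linarith)
  have next : j < j' → ¬ Valid n x y σ (i * n + j) (i' * n + j') →
      ∃ m' < n - j + (n - j'), MergeInv n x y σ α i i' s₀ m'
        { s with ireg := Function.update s.ireg 9 (j + 1) } := by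
    intro hjj hnv
    refine ⟨_, ?_, j + 1, j', by simp, by simp [e10], by omega, by omega, rfl, ?_,
      ⟨hs.rmem, hs.imem⟩, hE, ?_⟩
    · omega
    · intro r h1 h2
      simp [h1, hr r h1 h2]
    · intro j₀ h1 j₁ h2 h3 h4
      rcases Nat.lt_succ_iff_lt_or_eq.1 h1 with h5 | rfl
      · exact hv j₀ h5 j₁ h2 h3 h4
      · exact hnv (hmono j₁ h2 h3 h4 hjj)
  have next' : ∀ s' : State, s'.ireg = s.ireg → SameOld n s s' →
      Entries n x y σ α i (i' * n + (j' + 1)) s' →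
      ∃ m' < n - j + (n - j'), MergeInv n x y σ α i i' s₀ m'
        { s' with ireg := Function.update s'.ireg 10 (j' + 1) } := by
    intro s' h1 h2 h3
    have h4 := hs.trans h2
    refine ⟨_, ?_, j, j' + 1, by simp [h1, e9], by simp, by omega, by omega, rfl, ?_,
      ⟨h4.rmem, h4.imem⟩, h3, fun j₀ h5 j₁ h6 => hv j₀ h5 j₁ (by omega)⟩
    · omega
    · intro r h5 h6
      simp [h6, h1, hr r h5 h6]
  have stay := next' s rfl (.refl n s)
  refine Ends.of_wp ?_
  simp only [mergeBody, Prog.wp, Test.Safe, Test.Holds, IExpr.Safe, IExpr.val, RExpr.Safe,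
    RExpr.val, slopeE, yE, tabE, newTabE, newAncE, idxE, e0, e1, e7, e8, e9, e10, lim, two, hxi,
    hxi', hyj, hyj', hσ, hα, hslope, not_not, not_and_or, Rat.cast_zero, hx0, ne_eq,
    not_false_eq_true, true_and, and_true]
  refine ⟨fun hjj => ⟨⟨by omega, fun _ => by omega⟩, fun hval => ⟨by omega, fun hlt => ⟨by omega,
    by omega, by omega, by omega, by omega, by omega, by omega, next' { s with
      imem := Function.update s.imem (n * n + (i' * n + j')) (α (i * n + j))
      rmem := Function.update s.rmem (2 * n + n * n + (i' * n + j'))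
        (slope n x y (i * n + j) (i' * n + j')) } rfl ⟨fun a ha => ?_, fun a ha => ?_⟩
      fun q hq' => ?_⟩, fun hge => ⟨by omega, stay fun q hq' => ?_⟩⟩,
    fun hval => ⟨by omega, next hjj fun h => hval (hvalid.1 h).2⟩⟩,
    fun hjj => ⟨by omega, stay (hE.skip (by omega) fun q hq' h1 h2 j₀ hj₀ h3 => ?_)⟩⟩
  · simp only
    rw [Function.update_of_ne (by omega)]
  · simp only
    rw [Function.update_of_ne (by omega)]
  · have h1 := hE q hq'
    by_cases hqq : q = i' * n + j'
    · subst hqq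
      rw [if_neg (lt_irrefl _)] at h1
      have h2 := Entry.update hy hq h9 h1 (hvalid.2 ⟨hjj, hval⟩)
        (fun j₀ h3 => hv j₀ h3 j' le_rfl h10)
      rw [if_pos hlt, if_pos hlt] at h2
      rw [if_pos (by omega)]
      simpa using h2
    · simp only
      rw [Function.update_of_ne (by omega), Function.update_of_ne (by omega)]
      convert h1 using 3
      omega
  · have h1 := hE q hq'
    by_cases hqq : q = i' * n + j'
    · subst hqq
      rw [if_neg (lt_irrefl _)] at h1
      have h2 := Entry.update hy hq h9 h1 (hvalid.2 ⟨hjj, hval⟩)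
        (fun j₀ h3 => hv j₀ h3 j' le_rfl h10)
      rw [if_neg hge, if_neg hge] at h2
      rwa [if_pos (by omega)]
    · convert h1 using 3
      omega
  -- Here the source pointer has reached the target row: source rows from `j` on are not below the
  -- target, and those below `j` are excluded by the invariant.
  · obtain rfl : q = i' * n + j' := by omega
    have h4 := h3.2.1
    rw [idx_mod hj₀, idx_mod h10] at h4
    exact hv j₀ (by omega) j' le_rfl h10 h3

theorem time_mergeBody : mergeBody.time ≤ 400 := by
  simp [mergeBody, Prog.time, Test.cost, IExpr.cost, RExpr.cost, slopeE, yE, tabE, newTabE,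
    newAncE, idxE]

/-- Each round moves one of two pointers up by one, which leaves at most `2n` rounds of constant
cost. -/
theorem ends_merge (hy : StrictMonoOn y (Set.Iio n)) {i i' : ℕ} {s₀ : State}
    (hg : Grid n x y s₀) (ht : Table n σ α s₀) (hi : i < n) (hi' : i' < n)
    (h7 : s₀.ireg 7 = i) (h8 : s₀.ireg 8 = i') (hx : x i < x i')
    (h : Entries n x y σ α i (i' * n) s₀) :
    Ends (lim n) merge s₀ (1000 * (n + 1))
      (fun s => SameOld n s₀ s ∧ Entries n x y σ α i ((i' + 1) * n) s) := by
  have hb := time_mergeBody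
  have key := Ends.while (L := lim n)
    (c := .conj (.ilt (.reg 9) (.reg 0)) (.ilt (.reg 10) (.reg 0)))
    (p := mergeBody) (I := MergeInv n x y σ α i i' s₀)
    (Q := fun s => SameOld n s₀ s ∧ Entries n x y σ α i ((i' + 1) * n) s)
    (B := mergeBody.time) ?_ ?_ ?_ (n + n)
  · refine (Ends.seq ((Ends.of_wp (Q := fun s => MergeInv n x y σ α i i' s₀ (n + n) s) ?_).mono
      le_rfl fun s hs => key s hs)).mono ?_ fun _ => id
    · refine ⟨Nat.zero_le _, Nat.zero_le _, 0, 0, by simp [IExpr.val], by simp [IExpr.val],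
        Nat.zero_le n, Nat.zero_le n, rfl, ?_, ⟨fun _ _ => rfl, fun _ _ => rfl⟩, h, ?_⟩
      · intro r h1 h2
        simp [h1, h2]
      · intro j₀ h1
        omega
    · simp only [Prog.time, Test.cost, IExpr.cost]
      have := Nat.mul_le_mul_left (n + n) hb
      simp only [Nat.mul_add]
      omega
  · intro m s hs
    simp [Test.Safe, IExpr.Safe]
  · rintro m s hs hc
    have e0 : s.ireg 0 = n := by
      obtain ⟨j, j', e9, e10, -, -, -, hr, -⟩ := hs
      rw [hr 0 (by simp) (by simp), hg.n_eq]
    simp only [Test.Holds, IExpr.val, e0] at hc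
    exact ends_mergeBody hy hg ht hi hi' h7 h8 hx hs hc.1 hc.2
  · rintro m s ⟨j, j', e9, e10, hj, hj', -, hr, hs, hE, hv⟩ hc
    have e0 : s.ireg 0 = n := by rw [hr 0 (by simp) (by simp), hg.n_eq]
    simp only [Test.Holds, IExpr.val, e0, e9, e10] at hc
    -- One pointer has run off the column. If it is the source pointer, the invariant excludes all
    -- sources for the remaining targets; otherwise no targets remain.
    refine ⟨hs, hE.skip (by rw [Nat.add_mul]; omega) fun q hq h1 h2 j₀ hj₀ => ?_⟩
    obtain ⟨d, rfl⟩ := Nat.exists_eq_add_of_le h1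
    rw [Nat.add_mul] at h2
    rw [Nat.add_assoc]
    exact hv j₀ (by omega) (j' + d) (by omega) (by omega)

end

/-! ### From one table to the next in cubic time -/

/-- Nothing but the two tables has changed. -/
structure SameOuter (n : ℕ) (s s' : State) : Prop where
  rmem : ∀ a, a < 2 * n ∨ 2 * n + 2 * (n * n) ≤ a → s'.rmem a = s.rmem a
  imem : ∀ a, 2 * (n * n) ≤ a → s'.imem a = s.imem a

theorem SameOuter.trans {n : ℕ} {s s' s'' : State} (h : SameOuter n s s')
    (h' : SameOuter n s' s'') : SameOuter n s s'' :=
  ⟨fun a ha => (h'.rmem a ha).trans (h.rmem a ha), fun a ha => (h'.imem a ha).trans (h.imem a ha)⟩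

theorem SameOld.outer {n : ℕ} {s s' : State} (h : SameOld n s s') : SameOuter n s s' :=
  ⟨fun a ha => h.rmem a (ha.imp (fun h => by omega) id), fun a ha => h.imem a (.inr ha)⟩

/-- Bookkeeping for nested loops: one more loop raises the power by one and the constant by the
overhead 8 of `Ends.forLoop`. -/
theorem loop_time (N c k : ℕ) (hN : 1 ≤ N) : N * (c * N ^ k + 8) ≤ (c + 8) * N ^ (k + 1) := by
  have : 1 ≤ N ^ k := Nat.one_le_pow _ _ hN
  calc N * (c * N ^ k + 8) ≤ N * (c * N ^ k + 8 * N ^ k) :=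
        Nat.mul_le_mul_left _ (by omega)
    _ = (c + 8) * N ^ (k + 1) := by ring

theorem sq_loop_time (n c : ℕ) : (n * n + 1) * (c + 8) ≤ (c + 8) * (n + 1) ^ 2 := by
  rw [Nat.mul_comm]
  exact Nat.mul_le_mul_left _ (by nlinarith)

def clearTab : Prog := forLoop 12 1 (.setRMem (newTabE (.reg 12)) (.const 0))

/-- Columns need not be sorted, since their abscissae are compared here. The source column is the
outer loop, so candidates are met in the order of their indices, as the tie-breaking rule requires.
-/
def mergePairs : Prog :=
  forLoop 7 0 (forLoop 8 0 (.ite (.rlt (.mem (.reg 7)) (.mem (.reg 8))) merge .skip))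

def copyTab : Prog :=
  forLoop 12 1 (.seq (.setRMem (tabE (.reg 12)) (.mem (newTabE (.reg 12))))
    (.setIMem (.reg 12) (.mem (newAncE (.reg 12)))))

/-- Replaces the table by the table for chains with one more point, and the ancestors
accordingly. -/
def step : Prog := .seq clearTab (.seq mergePairs copyTab)

section
variable {n : ℕ} {x y : ℕ → ℝ} {σ : ℕ → ℝ} {α : ℕ → ℕ} {s₀ : State}

theorem ends_clearTab (hg : Grid n x y s₀) :
    Ends (lim n) clearTab s₀ (30 * (n + 1) ^ 2)
      (fun s => SameOld n s₀ s ∧ Entries n x y σ α 0 0 s) := by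
  refine (Ends.forLoop (B := 10) (m := n * n) (I := fun k s => SameOld n s₀ s ∧
    ∀ q < k, s.rmem (2 * n + n * n + q) = 0) (by decide) (by decide) (by decide)
    (by simp only [lim]; omega) hg.nn_eq ⟨⟨fun _ _ => rfl, fun _ _ => rfl⟩, by simp⟩ ?_).mono ?_ ?_
  · rintro k s hk h12 h1 hf ⟨hs, h⟩
    have e0 : s.ireg 0 = n := (hf.ireg 0 (by decide)).trans hg.n_eq
    refine (Ends.of_wp ?_).mono (by decide) fun _ => id
    have two : n + n = 2 * n := by omega
    simp only [Prog.wp, IExpr.Safe, IExpr.val, RExpr.Safe, RExpr.val, newTabE, e0, h1, h12, lim,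
      true_and, two]
    refine ⟨by omega, by omega, hs.trans ⟨fun a ha => ?_, fun _ _ => rfl⟩, fun q hq => ?_⟩
    · simp only
      rw [Function.update_of_ne (by omega)]
    · rcases Nat.lt_succ_iff_lt_or_eq.1 hq with h5 | rfl
      · rw [Function.update_of_ne (by omega), h q h5]
      · simp
  · have := sq_loop_time n 10
    omega
  · rintro s ⟨hs, h⟩
    -- An entry `0` puts no condition on its ancestor, so the integer memory is not cleared.
    exact ⟨hs, fun q hq => .inl ⟨h q hq, fun p hp => by simp at hp⟩⟩

theorem ends_mergePairs (hy : StrictMonoOn y (Set.Iio n)) (hg : Grid n x y s₀)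
    (ht : Table n σ α s₀) (hE : Entries n x y σ α 0 0 s₀) :
    Ends (lim n) mergePairs s₀ (1030 * (n + 1) ^ 3)
      (fun s => SameOld n s₀ s ∧ Entries n x y σ α n 0 s) := by
  have hnn := Nat.le_mul_self n
  refine (Ends.forLoop (B := 1018 * (n + 1) ^ 2) (m := n)
    (I := fun i s => SameOld n s₀ s ∧ Entries n x y σ α i 0 s) (by decide) (by decide) (by decide)
    (by simp only [lim]; omega) hg.n_eq ⟨⟨fun _ _ => rfl, fun _ _ => rfl⟩, hE⟩ ?_).mono
    ((loop_time (n + 1) 1018 2 (by omega)).trans (Nat.mul_le_mul_right _ (by omega)))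
    fun _ => id
  rintro i s hi h7 h0 hf ⟨hs, h⟩
  have hg' := hs.grid hg (hf.ireg 0 (by decide)) (hf.ireg 1 (by decide))
  have ht' := hs.table ht
  refine (Ends.forLoop (B := 1010 * (n + 1) ^ 1) (m := n)
    (I := fun i' s => SameOld n s₀ s ∧ Entries n x y σ α i (i' * n) s) (by decide) (by decide)
    (by decide) (by simp only [lim]; omega) h0
    ⟨⟨hs.rmem, hs.imem⟩, by rw [Nat.zero_mul]; exact h⟩ ?_).mono
    (loop_time (n + 1) 1010 1 (by omega)) fun s h => ⟨⟨h.1.rmem, h.1.imem⟩, h.2.zero_of_sq⟩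
  rintro i' s' hi' h8 h0' hf' ⟨hs', h'⟩
  have hg'' := hs'.grid hg ((hf'.ireg 0 (by decide)).trans (hf.ireg 0 (by decide)))
    ((hf'.ireg 1 (by decide)).trans (hf.ireg 1 (by decide)))
  have ht'' := hs'.table ht
  have h7' := (hf'.ireg 7 (by decide)).trans h7
  refine (Ends.ite (T := 1000 * (n + 1)) ?_ (fun hc => ?_) (fun hc => ?_)).mono ?_ fun _ => id
  · simp only [Test.Safe, RExpr.Safe, IExpr.Safe, IExpr.val, h7', h8, lim, true_and]
    omega
  · simp only [Test.Holds, RExpr.val, IExpr.val, h7', h8, hg''.x_eq i hi, hg''.x_eq i' hi'] at hc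
    exact (ends_merge hy hg'' ht'' hi hi' h7' h8 hc h').mono le_rfl fun s h =>
      ⟨⟨(hs'.trans h.1).rmem, (hs'.trans h.1).imem⟩, h.2⟩
  · simp only [Test.Holds, RExpr.val, IExpr.val, h7', h8, hg''.x_eq i hi, hg''.x_eq i' hi'] at hc
    refine (Ends.of_wp (p := .skip) (show Prog.wp _ _ (fun s => _ ∧ _) _ from
      ⟨⟨hs'.rmem, hs'.imem⟩, ?_⟩)).mono (by simp only [Prog.time]; omega) fun _ => id
    -- A source column that is not to the left of the target column has no valid points.
    refine Entries.skip h' (Nat.mul_le_mul_right _ (by omega)) fun q hq h1 h2 j hj hv => hc ?_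
    obtain ⟨d, rfl⟩ := Nat.exists_eq_add_of_le h1
    have hd : d < n := by rw [Nat.add_mul] at h2; omega
    have := hv.1
    rwa [idx_div hj, idx_div hd] at this
  · simp only [Test.cost, RExpr.cost, IExpr.cost, Nat.pow_one]
    omega

theorem ends_copyTab (hg : Grid n x y s₀) {τ : ℕ → ℝ} {β : ℕ → ℕ}
    (hτ : ∀ q < n * n, s₀.rmem (2 * n + n * n + q) = τ q)
    (hβ : ∀ q < n * n, s₀.imem (n * n + q) = β q) :
    Ends (lim n) copyTab s₀ (40 * (n + 1) ^ 2)
      (fun s => SameOuter n s₀ s ∧ Table n τ β s) := by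
  refine (Ends.forLoop (B := 30) (m := n * n) (I := fun k s => SameOuter n s₀ s ∧
    (∀ q < n * n, s.rmem (2 * n + n * n + q) = τ q) ∧
    (∀ q < n * n, s.imem (n * n + q) = β q) ∧
    ∀ q < k, s.rmem (2 * n + q) = τ q ∧ s.imem q = β q) (by decide) (by decide) (by decide)
    (by simp only [lim]; omega) hg.nn_eq ⟨⟨fun _ _ => rfl, fun _ _ => rfl⟩, hτ, hβ, by simp⟩
    ?_).mono ?_ ?_
  · rintro k s hk h12 h1 hf ⟨hs, hτ', hβ', h⟩
    have e0 : s.ireg 0 = n := (hf.ireg 0 (by decide)).trans hg.n_eq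
    refine (Ends.of_wp ?_).mono (by decide) fun _ => id
    have two : n + n = 2 * n := by omega
    simp only [Prog.wp, IExpr.Safe, IExpr.val, RExpr.Safe, RExpr.val, newTabE, tabE, newAncE, e0,
      h1, h12, lim, true_and, two, hτ' k hk, hβ' k hk]
    refine ⟨by omega, by omega, by omega, by omega, by omega,
      hs.trans ⟨fun a ha => ?_, fun a ha => ?_⟩, fun q hq => ?_, fun q hq => ?_,
      fun q hq => ?_⟩
    · simp only
      rw [Function.update_of_ne (by omega)]
    · simp only
      rw [Function.update_of_ne (by omega)]
    · rw [Function.update_of_ne (by omega), hτ' q hq]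
    · rw [Function.update_of_ne (by omega), hβ' q hq]
    · rcases Nat.lt_succ_iff_lt_or_eq.1 hq with h5 | rfl
      · rw [Function.update_of_ne (by omega), Function.update_of_ne (by omega)]
        exact h q h5
      · simp
  · have := sq_loop_time n 30
    omega
  · rintro s ⟨hs, -, -, h⟩
    exact ⟨hs, fun q hq => (h q hq).1, fun q hq => (h q hq).2⟩

theorem ends_step (hy : StrictMonoOn y (Set.Iio n)) (hg : Grid n x y s₀)
    (ht : Table n σ α s₀) :
    Ends (lim n) step s₀ (1100 * (n + 1) ^ 3) (fun s => SameOuter n s₀ s ∧ ∃ β,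
      Table n (nxt n x y σ) β s ∧
      ∀ q < n * n, nxt n x y σ q ≠ 0 → β q = α (pred n x y σ q)) := by
  refine (Ends.seq_of (ends_clearTab (σ := σ) (α := α) hg) fun s₁ ⟨hs₁, h₁⟩ hf₁ =>
    Ends.seq_of (ends_mergePairs hy (hs₁.grid hg (hf₁.ireg 0 (by decide))
      (hf₁.ireg 1 (by decide))) (hs₁.table ht) h₁)
      fun s₂ ⟨hs₂, h₂⟩ hf₂ => ((ends_copyTab (τ := nxt n x y σ)
        (β := fun q => s₂.imem (n * n + q)) ((hs₁.trans hs₂).grid hg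
        ((hf₂.ireg 0 (by decide)).trans (hf₁.ireg 0 (by decide)))
        ((hf₂.ireg 1 (by decide)).trans (hf₁.ireg 1 (by decide)))) (fun q hq => ?_)
        (fun q hq => rfl))).mono le_rfl
        fun s ⟨hs, h⟩ => ⟨((hs₁.trans hs₂).outer).trans hs, _, h,
          fun q hq => Entry.eq_pred (h₂ q hq)⟩).mono ?_
        fun _ => id
  · exact Entry.eq_nxt (h₂ q hq)
  · have : (n + 1) ^ 2 ≤ (n + 1) ^ 3 := Nat.pow_le_pow_right (by omega) (by omega)
    omega

end

/-! ### Running through all tables -/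

def firstTab : Prog := forLoop 12 1 (.setRMem (tabE (.reg 12)) (.const (-1)))

/-- Computes all tables in turn and runs `hook` for each of them. -/
def levels (hook : Prog) : Prog :=
  .seq firstTab (.seq (.setIReg 5 (.const 1)) (upto 5 15 (.seq hook step)))

section
variable {n : ℕ} {x y : ℕ → ℝ} {s₀ : State}

theorem ends_firstTab (hg : Grid n x y s₀) :
    Ends (lim n) firstTab s₀ (30 * (n + 1) ^ 2)
      (fun s => SameOuter n s₀ s ∧ ∀ q < n * n, s.rmem (2 * n + q) = -1) := by
  refine (Ends.forLoop (B := 10) (m := n * n) (I := fun k s => SameOuter n s₀ s ∧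
    ∀ q < k, s.rmem (2 * n + q) = -1) (by decide) (by decide) (by decide)
    (by simp only [lim]; omega) hg.nn_eq ⟨⟨fun _ _ => rfl, fun _ _ => rfl⟩, by simp⟩ ?_).mono ?_
    fun _ => id
  · rintro k s hk h12 h1 hf ⟨hs, h⟩
    have e0 : s.ireg 0 = n := (hf.ireg 0 (by decide)).trans hg.n_eq
    refine (Ends.of_wp ?_).mono (by decide) fun _ => id
    have two : n + n = 2 * n := by omega
    simp only [Prog.wp, IExpr.Safe, IExpr.val, RExpr.Safe, RExpr.val, tabE, e0, h12, lim,
      true_and, two]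
    refine ⟨by omega, by omega, hs.trans ⟨fun a ha => ?_, fun _ _ => rfl⟩, fun q hq => ?_⟩
    · simp only
      rw [Function.update_of_ne (by omega)]
    · rcases Nat.lt_succ_iff_lt_or_eq.1 hq with h5 | rfl
      · rw [Function.update_of_ne (by omega), h q h5]
      · simp
  · have := sq_loop_time n 10
    omega

/-- Shared by the search for the size and by the passes for the vertices. The predicate `J k α` is
the invariant of the hook before table `k`. The hook may replace the ancestors by `α'`; it must then
guarantee `J (k + 1)` for whatever `step` can produce, which is known only through the untouched
registers, the integer cells beyond the tables, and the ancestors handed on along `pred`. -/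
theorem ends_levels (hy : StrictMonoOn y (Set.Iio n)) (hg : Grid n x y s₀)
    (h15 : s₀.ireg 15 = n + 1) {hook : Prog} (hw : ∀ r ∈ [0, 1, 5, 15], r ∉ hook.writes)
    (hmem : hook.keepsRMem = true) (J : ℕ → (ℕ → ℕ) → State → Prop)
    (hJ : ∀ α s, (∀ r, r ≠ 5 → r ≠ 12 → s.ireg r = s₀.ireg r) →
      (∀ a, 2 * (n * n) ≤ a → s.imem a = s₀.imem a) → J 1 α s)
    (hhook : ∀ k α s, 1 ≤ k → k ≤ n → s.ireg 5 = k → Grid n x y s →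
      Table n (lev n x y k) α s → J k α s →
      Ends (lim n) hook s (100 * (n + 1) ^ 3) fun s' => ∃ α' : ℕ → ℕ,
        (∀ p < n * n, s'.imem p = α' p) ∧ ∀ s'' β,
          (∀ r, r ∉ 5 :: step.writes → s''.ireg r = s'.ireg r) →
          (∀ a, 2 * (n * n) ≤ a → s''.imem a = s'.imem a) →
          (∀ q < n * n, lev n x y (k + 1) q ≠ 0 → β q = α' (pred n x y (lev n x y k) q)) →
          J (k + 1) β s'') :
    Ends (lim n) (levels hook) s₀ (1300 * (n + 1) ^ 4) (fun s =>
      (∀ a, a < 2 * n ∨ 2 * n + 2 * (n * n) ≤ a → s.rmem a = s₀.rmem a) ∧ ∃ α, J (n + 1) α s) := by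
  have hw' := fun r hr => hw r hr
  simp only [List.mem_cons, List.not_mem_nil, or_false, forall_eq_or_imp, forall_eq] at hw
  obtain ⟨w0, w1, w5, w15⟩ := hw
  have hupto : ∀ r ∈ [0, 1, 15], r ∉ (upto 5 15 (.seq hook step)).writes := by
    intro r hr
    simp only [upto, Prog.writes, List.mem_append, List.mem_singleton, not_or]
    have h3 : r ∉ step.writes ∧ r ≠ 5 := by
      simp only [List.mem_cons, List.not_mem_nil, or_false] at hr
      rcases hr with rfl | rfl | rfl <;> decide
    refine ⟨⟨hw' r ?_, h3.1⟩, h3.2⟩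
    simp only [List.mem_cons, List.not_mem_nil, or_false] at hr ⊢
    omega
  refine (Ends.seq_of (ends_firstTab hg) fun s₁ ⟨hs₁, h₁⟩ hf₁ => Ends.seq_of (Ends.of_wp
    (p := .setIReg 5 (.const 1)) (Q := fun s => s = { s₁ with ireg := Function.update s₁.ireg 5 1 })
    ⟨by simp [IExpr.Safe, lim], rfl⟩) ?_).mono (T := _ + (2 + (n * (1208 * (n + 1) ^ 3) + 4))) ?_
    fun _ => id
  · rintro s rfl -
    refine (Ends.upto (B := 1200 * (n + 1) ^ 3) (m := n + 1) (k₀ := 1) (I := fun k s =>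
      (∀ a, a < 2 * n ∨ 2 * n + 2 * (n * n) ≤ a → s.rmem a = s₀.rmem a) ∧
      ∃ α, Table n (lev n x y k) α s ∧ J k α s) ?_ ?_ (by decide) (by simp only [lim]; omega)
      (by omega) (by simp) ?_ ?_ ?_).mono ?_ ?_
    · simp only [Prog.writes, List.mem_append, w5, false_or]
      decide
    · simp only [Prog.writes, List.mem_append, w15, false_or]
      decide
    · simp [hf₁.ireg 15 (by decide), h15]
    -- Table 1 has no meaningful ancestors; the present contents of the memory serve as `α`.
    · refine ⟨fun a ha => hs₁.rmem a ha, s₁.imem, ⟨h₁, fun _ _ => rfl⟩, hJ _ _ ?_ fun a ha =>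
        hs₁.imem a ha⟩
      intro r h5 h12
      simp only [Function.update_of_ne h5]
      exact hf₁.ireg r (by simp [firstTab, forLoop, upto, Prog.writes, h12])
    · rintro k s hk1 hk h5 - hf ⟨hs, α, ht, hj⟩
      have hgk : ∀ s', s'.ireg 0 = s.ireg 0 → s'.ireg 1 = s.ireg 1 → s'.rmem = s.rmem →
          Grid n x y s' := by
        intro s' e0 e1 er
        have f0 : s.ireg 0 = s₁.ireg 0 := (hf.ireg 0 (hupto 0 (by simp))).trans (by simp)
        have f1 : s.ireg 1 = s₁.ireg 1 := (hf.ireg 1 (hupto 1 (by simp))).trans (by simp)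
        refine ⟨?_, ?_, fun i hi => ?_, fun j hj => ?_⟩
        · rw [e0, f0, hf₁.ireg 0 (by decide), hg.n_eq]
        · rw [e1, f1, hf₁.ireg 1 (by decide), hg.nn_eq]
        · rw [er, hs _ (.inl (by omega)), hg.x_eq i hi]
        · rw [er, hs _ (.inl (by omega)), hg.y_eq j hj]
      refine (Ends.seq_of (T' := 1100 * (n + 1) ^ 3) (hhook k α s hk1 (by omega) h5
        (hgk s rfl rfl rfl) ht hj) ?_).mono (by omega) fun _ => id
      rintro s₂ ⟨α', hα', hJ'⟩ hf₂
      have hm₂ := hf₂.rmem hmem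
      refine (ends_step (σ := lev n x y k) (α := α') hy
        (hgk s₂ (hf₂.ireg 0 w0) (hf₂.ireg 1 w1) hm₂)
        ⟨fun p hp => by rw [hm₂, ht.tab p hp], hα'⟩).frame.mono le_rfl ?_
      rintro s₃ ⟨⟨hs₃, β, ht₃, hβ⟩, hf₃⟩
      rw [← lev_succ hk1] at ht₃ hβ
      refine ⟨fun a ha => ?_, β, ⟨ht₃.tab, ht₃.anc⟩, hJ' _ β (fun r hr => ?_) hs₃.imem hβ⟩
      · simp only
        rw [hs₃.rmem a ha, hm₂, hs a ha]
      · simp only [List.mem_cons, not_or] at hr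
        simp only [Function.update_of_ne hr.1]
        exact hf₃.ireg r hr.2
    · rw [Nat.add_sub_cancel]
      have : 1 ≤ (n + 1) ^ 3 := Nat.one_le_pow _ _ (by omega)
      have := Nat.mul_le_mul_left n (show 1200 * (n + 1) ^ 3 + 8 ≤ 1208 * (n + 1) ^ 3 by omega)
      omega
    · rintro s ⟨h, α, -, hj⟩
      exact ⟨h, α, hj⟩
  · have h1 : (n + 1) ^ 2 ≤ (n + 1) ^ 4 := Nat.pow_le_pow_right (by omega) (by omega)
    have h2 : n * (1208 * (n + 1) ^ 3) ≤ 1208 * (n + 1) ^ 4 := by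
      calc n * (1208 * (n + 1) ^ 3) ≤ (n + 1) * (1208 * (n + 1) ^ 3) :=
            Nat.mul_le_mul_right _ (by omega)
        _ = 1208 * (n + 1) ^ 4 := by ring
    have h3 : 1 ≤ (n + 1) ^ 4 := Nat.one_le_pow _ _ (by omega)
    omega

/-! ### The maximum size -/

/-- Only strict comparison of reals is available, so an entry is recognised as nonzero by its square
being positive. -/
def scan : Prog :=
  forLoop 12 1 (.ite (.rlt (.const 0) (.mul (.mem (tabE (.reg 12))) (.mem (tabE (.reg 12)))))
    (.seq (.setIReg 3 (.reg 5)) (.setIReg 4 (.reg 12))) .skip)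

/-- Computes the maximum size of an increasing convex chain, and the last vertex of such a
chain. -/
def sizePass : Prog := .seq (.setIReg 3 (.const 0)) (levels scan)

/-- `K` is the number of the last table with an entry, and `q` has an entry in it. -/
structure IsLast (n : ℕ) (x y : ℕ → ℝ) (K q : ℕ) : Prop where
  one_le : 1 ≤ K
  le_n : K ≤ n
  q_lt : q < n * n
  ne_zero : lev n x y K q ≠ 0
  max : ∀ m, 1 ≤ m → m ≤ n → (∃ q < n * n, lev n x y m q ≠ 0) → m ≤ K

/-- The invariant of `sizePass`. -/
structure ScanInv (n : ℕ) (x y : ℕ → ℝ) (k K q : ℕ) : Prop where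
  max : ∀ m, 1 ≤ m → m < k → (∃ q < n * n, lev n x y m q ≠ 0) → m ≤ K
  le_n : K ≤ n
  spec : 1 ≤ K → q < n * n ∧ lev n x y K q ≠ 0

theorem ends_scan {k : ℕ} {α : ℕ → ℕ} (hg : Grid n x y s₀) (hk : 1 ≤ k) (hkn : k ≤ n)
    (h5 : s₀.ireg 5 = k) (ht : Table n (lev n x y k) α s₀)
    (h : ScanInv n x y k (s₀.ireg 3) (s₀.ireg 4)) :
    Ends (lim n) scan s₀ (100 * (n + 1) ^ 2)
      (fun s => ScanInv n x y (k + 1) (s.ireg 3) (s.ireg 4)) := by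
  refine (Ends.forLoop (B := 50) (m := n * n) (I := fun p s =>
    ScanInv n x y k (s.ireg 3) (s.ireg 4) ∧ ((∃ q < p, lev n x y k q ≠ 0) → k ≤ s.ireg 3))
    (by decide) (by decide) (by decide) (by simp only [lim]; omega) hg.nn_eq
    ⟨by simpa using h, by simp⟩ ?_).mono ?_ ?_
  · rintro p s hp h12 h1 hf ⟨hs, hi⟩
    have e0 : s.ireg 0 = n := (hf.ireg 0 (by decide)).trans hg.n_eq
    have e5 : s.ireg 5 = k := (hf.ireg 5 (by decide)).trans h5
    have hm : s.rmem (2 * n + p) = lev n x y k p := by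
      rw [hf.rmem (by decide), ht.tab p hp]
    refine (Ends.of_wp ?_).mono (by decide) fun _ => id
    have two : n + n = 2 * n := by omega
    simp only [Prog.wp, IExpr.Safe, IExpr.val, RExpr.Safe, RExpr.val, Test.Safe, Test.Holds, tabE,
      e0, e5, h12, lim, true_and, two, hm, Rat.cast_zero, mul_self_pos]
    refine ⟨by omega, fun hne => ⟨⟨?_, ?_, ?_⟩, ?_⟩, fun hne => ⟨?_, ?_⟩⟩
    -- Overwriting the record by `k` is safe because all tables scanned before have smaller numbers.
    · intro m hm1 hmk _
      simp
      omega
    · simpa [Function.update_apply] using hkn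
    · intro _
      simpa [Function.update_apply, h12] using ⟨hp, hne⟩
    · simp
    · simpa [Function.update_apply] using hs
    · rintro ⟨q, hq, hq0⟩
      have := hi ⟨q, ?_, hq0⟩
      · simpa using this
      · rcases Nat.lt_succ_iff_lt_or_eq.1 hq with h5 | rfl
        · exact h5
        · exact absurd hq0 hne
  · exact sq_loop_time n 50 |>.trans (Nat.mul_le_mul_right _ (by omega))
  · rintro s ⟨hs, hi⟩
    refine ⟨fun m h1 h2 h3 => ?_, hs.le_n, hs.spec⟩
    rcases Nat.lt_succ_iff_lt_or_eq.1 h2 with h4 | rfl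
    · exact hs.max m h1 h4 h3
    · exact hi h3

theorem ends_sizePass (hn : 1 ≤ n) (hy : StrictMonoOn y (Set.Iio n)) (hg : Grid n x y s₀)
    (h15 : s₀.ireg 15 = n + 1) :
    Ends (lim n) sizePass s₀ (1400 * (n + 1) ^ 4) (fun s =>
      (∀ a, a < 2 * n ∨ 2 * n + 2 * (n * n) ≤ a → s.rmem a = s₀.rmem a) ∧
      IsLast n x y (s.ireg 3) (s.ireg 4)) := by
  refine (Ends.seq_of (Ends.of_wp (p := .setIReg 3 (.const 0))
    (Q := fun s => s = { s₀ with ireg := Function.update s₀.ireg 3 0 })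
    ⟨by simp [IExpr.Safe], rfl⟩) ?_).mono (T := 2 + 1300 * (n + 1) ^ 4) ?_ fun _ => id
  · rintro s rfl -
    refine (ends_levels (s₀ := { s₀ with ireg := Function.update s₀.ireg 3 0 }) hy
      ⟨by simpa using hg.n_eq, by simpa using hg.nn_eq, hg.x_eq, hg.y_eq⟩
      (by simpa using h15) (hook := scan) (by decide) (by decide)
      (fun k _ s => ScanInv n x y k (s.ireg 3) (s.ireg 4)) ?_ ?_).mono le_rfl ?_
    · intro α s hr _
      rw [hr 3 (by simp) (by simp)]
      exact ⟨fun m h1 h2 => by omega, by simp, by simp⟩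
    · intro k α s hk hkn h5 hg' ht h
      refine (ends_scan hg' hk hkn h5 ht h).frame.mono ?_ ?_
      · exact Nat.mul_le_mul_left _ (Nat.pow_le_pow_right (by omega) (by omega))
      · rintro s' ⟨h', hf⟩
        refine ⟨s'.imem, fun _ _ => rfl, fun s'' β hr _ _ => ?_⟩
        rwa [hr 3 (by decide), hr 4 (by decide)]
    · rintro s ⟨hs, α, h⟩
      -- Table 1 consists of entries `-1`, so the recorded size is positive and the recorded vertex
      -- is genuine.
      have h1 : 1 ≤ s.ireg 3 := h.max 1 le_rfl (by omega) ⟨0, Nat.mul_pos hn hn, by simp [lev]⟩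
      exact ⟨hs, h1, h.le_n, (h.spec h1).1, (h.spec h1).2, fun m hm hmn => h.max m hm (by omega)⟩
  · have h3 : 1 ≤ (n + 1) ^ 4 := Nat.one_le_pow _ _ (by omega)
    omega

end

/-! ### Rotating the grid -/

/-- Clockwise rotation by a right angle. -/
def rot (p : ℝ × ℝ) : ℝ × ℝ := (p.2, -p.1)

/-- The grid `A × B` after `r` rotations. -/
def turn (A B : Set ℝ) : ℕ → Set ℝ × Set ℝ
  | 0 => (A, B)
  | r + 1 => ((turn A B r).2, Neg.neg '' (turn A B r).1)

theorem turn_four (A B : Set ℝ) : turn A B 4 = (A, B) := by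
  simp [turn]

theorem IsConvexPolygon.rot {k : ℕ} {P : Fin k → ℝ × ℝ} (h : IsConvexPolygon P) :
    IsConvexPolygon (fun i => rot (P i)) := by
  intro i j l hij hjl
  have := h hij hjl
  simp only [orient, GridChain.rot] at this ⊢
  linarith

theorem IsConvexChain.rot {k : ℕ} {P : Fin k → ℝ × ℝ} (h : IsConvexChain P) :
    IsConvexChain (fun i => rot (P i)) := by
  refine ⟨h.convex.rot, h.y_mono, ?_⟩
  rcases h.x_mono with h | h
  · exact .inr fun _ _ hij => neg_lt_neg (h hij)
  · exact .inl fun _ _ hij => neg_lt_neg (h hij)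

theorem Supports.rot {k : ℕ} {A B : Set ℝ} {P : Fin k → ℝ × ℝ} (h : Supports A B P) :
    Supports B (Neg.neg '' A) (fun i => rot (P i)) :=
  ⟨fun i => ⟨(h.mem i).2, _, (h.mem i).1, rfl⟩, h.y_inj, fun _ _ hij => h.x_inj (neg_injective hij)⟩

/-- Increasing convex chains in `A × B` have at most `m` points. -/
def IncBound (A B : Set ℝ) (m : ℕ) : Prop :=
  ∀ k (P : Fin k → ℝ × ℝ), IsConvexPolygon P → StrictMono (fun i => (P i).1) →
    StrictMono (fun i => (P i).2) → (∀ i, P i ∈ A ×ˢ B) → k ≤ m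

theorem IncBound.mono {A B : Set ℝ} {m m' : ℕ} (h : IncBound A B m) (hm : m ≤ m') :
    IncBound A B m' := fun k P h1 h2 h3 h4 => (h k P h1 h2 h3 h4).trans hm

/-- Every convex chain is increasing after at most three rotations. -/
theorem le_of_incBound {A B : Set ℝ} {m k : ℕ} {P : Fin k → ℝ × ℝ}
    (h : ∀ r, 1 ≤ r → r ≤ 4 → IncBound (turn A B r).1 (turn A B r).2 m) (hP : IsConvexChain P)
    (hS : Supports A B P) : k ≤ m := by
  have h1 := hS.rot
  have h2 := h1.rot
  have h3 := h2.rot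
  rcases hP.x_mono with hx | hx <;> rcases hP.y_mono with hy | hy
  · have := h 4 (by omega) le_rfl
    rw [turn_four] at this
    exact this k P hP.convex hx hy hS.mem
  · exact h 3 (by omega) (by omega) k _ hP.rot.rot.rot.convex (fun i j hij => neg_lt_neg (hy hij))
      (fun i j hij => neg_lt_neg (neg_lt_neg (hx hij))) h3.mem
  · exact h 1 le_rfl (by omega) k _ hP.rot.convex hy (fun i j hij => neg_lt_neg (hx hij)) h1.mem
  · exact h 2 (by omega) (by omega) k _ hP.rot.rot.convex (fun i j hij => neg_lt_neg (hx hij))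
      (fun i j hij => neg_lt_neg (hy hij)) h2.mem

/-- A chain of `k` points has `k ≤ n` and makes table `k` nonempty, and no table up to `n` beyond
`K` is nonempty. -/
theorem IsLast.incBound {n : ℕ} {x y : ℕ → ℝ} {K q : ℕ} (hy : StrictMonoOn y (Set.Iio n))
    (h : IsLast n x y K q) : IncBound (x '' Set.Iio n) (y '' Set.Iio n) K := by
  intro k P h1 h2 h3 h4
  rcases Nat.eq_zero_or_pos k with rfl | hk
  · exact Nat.zero_le _
  · exact h.max k hk (card_le_of_mem h2 fun i => (h4 i).1) (exists_lev_ne_zero hy hk h1 h2 h3 h4)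

/-- The grid `A × B` is stored, in any order. -/
def HasGrid (n : ℕ) (A B : Set ℝ) (s : State) : Prop :=
  ∃ x y, Grid n x y s ∧ Set.InjOn x (Set.Iio n) ∧ Set.InjOn y (Set.Iio n) ∧
    x '' Set.Iio n = A ∧ y '' Set.Iio n = B

def rotGrid : Prog :=
  forLoop 12 0 (.seq (.setRReg 0 (.mem (.reg 12))) (.seq
    (.setRMem (.reg 12) (.mem (yE (.reg 12))))
    (.setRMem (yE (.reg 12)) (.sub (.const 0) (.reg 0)))))

/-- Only the rows must be sorted, for the two pointers of `merge`. A quadratic exchange sort stays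
well within the time bound. -/
def sortRows : Prog :=
  forLoop 12 0 (.seq (.setIReg 13 (.add (.reg 12) (.const 1)))
    (upto 13 0 (.ite (.rlt (.mem (yE (.reg 13))) (.mem (yE (.reg 12))))
      (.seq (.setRReg 0 (.mem (yE (.reg 12)))) (.seq
        (.setRMem (yE (.reg 12)) (.mem (yE (.reg 13))))
        (.setRMem (yE (.reg 13)) (.reg 0)))) .skip)))

/-- Rotates the grid and computes the maximum size of an increasing convex chain in it. -/
def findSize : Prog := .seq rotGrid (.seq sortRows sizePass)

section
variable {n : ℕ} {x y : ℕ → ℝ} {s₀ : State}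

theorem ends_rotGrid (hg : Grid n x y s₀) :
    Ends (lim n) rotGrid s₀ (40 * (n + 1) ^ 2) (fun s => Grid n y (fun i => -x i) s ∧
      ∀ a, 2 * n ≤ a → s.rmem a = s₀.rmem a) := by
  have hnn := Nat.le_mul_self n
  refine (Ends.forLoop (B := 20) (m := n) (I := fun k s =>
    (∀ a, 2 * n ≤ a → s.rmem a = s₀.rmem a) ∧
    (∀ i < n, s.rmem i = if i < k then y i else x i) ∧
    (∀ i < n, s.rmem (n + i) = if i < k then -x i else y i)) (by decide) (by decide) (by decide)
    (by simp only [lim]; omega) hg.n_eq ⟨fun _ _ => rfl, by simpa using hg.x_eq,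
      by simpa using hg.y_eq⟩ ?_).frame.mono ?_ ?_
  · rintro k s hk h12 h0 hf ⟨hs, hx, hy⟩
    refine (Ends.of_wp ?_).mono (by decide) fun _ => id
    have hxk := hx k hk
    have hyk := hy k hk
    rw [if_neg (lt_irrefl _)] at hxk hyk
    simp only [Prog.wp, IExpr.Safe, IExpr.val, RExpr.Safe, RExpr.val, yE, h0, h12, lim,
      true_and, and_true, hyk, hxk, Rat.cast_zero, zero_sub]
    refine ⟨by omega, by omega, by omega, by omega, by omega, fun a ha => ?_, fun i hi => ?_,
      fun i hi => ?_⟩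
    · rw [Function.update_of_ne (by omega), Function.update_of_ne (by omega), hs a ha]
    · rw [Function.update_of_ne (by omega)]
      by_cases hik : i = k
      · subst hik
        simp
      · rw [Function.update_of_ne hik, hx i hi]
        congr 1
        apply propext; omega
    · by_cases hik : i = k
      · subst hik
        simp
      · rw [Function.update_of_ne (by omega), Function.update_of_ne (by omega), hy i hi]
        congr 1
        apply propext; omega
  · nlinarith
  · rintro s ⟨⟨hs, hx, hy⟩, hf⟩
    refine ⟨⟨(hf.ireg 0 (by decide)).trans hg.n_eq, (hf.ireg 1 (by decide)).trans hg.nn_eq,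
      fun i hi => ?_, fun i hi => ?_⟩, hs⟩
    · rw [hx i hi, if_pos hi]
    · rw [hy i hi, if_pos hi]

/-- The invariant of `sortRows`. -/
def SortInv (n : ℕ) (y : ℕ → ℝ) (s₀ : State) (k l : ℕ) (s : State) : Prop :=
  ∃ y' : ℕ → ℝ, (∀ a, a < n ∨ 2 * n ≤ a → s.rmem a = s₀.rmem a) ∧
    (∀ i < n, s.rmem (n + i) = y' i) ∧ Set.InjOn y' (Set.Iio n) ∧
    y' '' Set.Iio n = y '' Set.Iio n ∧ (∀ a < k, ∀ b < n, a < b → y' a < y' b) ∧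
    ∀ b < n, k < b → b < l → y' k < y' b

theorem ends_sortRows (hg : Grid n x y s₀) (hy : Set.InjOn y (Set.Iio n)) :
    Ends (lim n) sortRows s₀ (100 * (n + 1) ^ 2) (fun s => ∃ y', Grid n x y' s ∧
      StrictMonoOn y' (Set.Iio n) ∧ y' '' Set.Iio n = y '' Set.Iio n ∧
      ∀ a, 2 * n ≤ a → s.rmem a = s₀.rmem a) := by
  have hnn := Nat.le_mul_self n
  have key : Ends (lim n) sortRows s₀ ((n + 1) * (60 * (n + 1) ^ 1 + 8))
      (SortInv n y s₀ n (n + 1)) := by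
    refine Ends.forLoop (I := fun k => SortInv n y s₀ k (k + 1)) (by decide) (by decide)
      (by decide) (by simp only [lim]; omega) hg.n_eq
      ?_ ?_
    · exact ⟨y, fun _ _ => rfl, hg.y_eq, hy, rfl, by simp, by omega⟩
    · rintro k s hk h12 h0 hf ⟨y', hs, hy', hinj, him, hlt, -⟩
      refine (Ends.seq_of (Ends.of_wp (p := .setIReg 13 (.add (.reg 12) (.const 1)))
        (Q := fun s' => s' = { s with ireg := Function.update s.ireg 13 (k + 1) })
        ⟨by simp only [IExpr.Safe, IExpr.val, lim, h12, true_and]; omega, by simp [IExpr.val, h12]⟩)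
        (T' := n * (35 + 8) + 4) ?_).mono ?_ fun _ => id
      · rintro s' rfl -
        refine (Ends.upto (B := 35) (m := n) (k₀ := k + 1) (I := SortInv n y s₀ k) (by decide)
          (by decide) (by decide) (by simp only [lim]; omega) (by omega) (by simp) (by simp [h0])
          ?_ ?_).mono ?_ ?_
        · exact ⟨y', hs, hy', hinj, him, hlt, fun b _ _ _ => by omega⟩
        · rintro l s₁ hkl hl h13 h0' hf' ⟨z, hs', hz, hinj, him, hlt, hltk⟩
          have e12 : s₁.ireg 12 = k := (hf'.ireg 12 (by decide)).trans (by simp [h12])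
          refine (Ends.of_wp ?_).mono (by decide) fun _ => id
          simp only [Prog.wp, IExpr.Safe, IExpr.val, RExpr.Safe, RExpr.val, Test.Safe, Test.Holds,
            yE, h0', h13, e12, lim, true_and, hz k hk, hz l hl]
          -- Exchanging two cells composes the row values with a transposition. Rows before `k` stay
          -- below all later ones, as both exchanged values come from later rows.
          refine ⟨by omega, fun hc => ⟨by omega, by omega, by omega, by omega, by omega, by omega,
            z ∘ Equiv.swap k l, fun a ha => ?_, fun i hi => ?_, ?_, ?_, fun a ha b hb hab => ?_,
            fun b hb hkb hbl => ?_⟩, fun hc => ⟨z, hs', hz, hinj, him, hlt, fun b hb hkb hbl => ?_⟩⟩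
          · simp only
            rw [Function.update_of_ne (by omega), Function.update_of_ne (by omega), hs' a ha]
          · simp only [Function.comp]
            by_cases hil : i = l
            · subst hil
              simp
            · rw [Function.update_of_ne (by omega)]
              by_cases hik : i = k
              · subst hik
                simp
              · rw [Function.update_of_ne (by omega), Equiv.swap_apply_of_ne_of_ne hik hil, hz i hi]
          · refine hinj.comp (Equiv.injective _).injOn fun i hi => ?_
            rw [Set.mem_Iio] at hi ⊢
            rw [Equiv.swap_apply_def]
            split_ifs <;> omega
          · rw [← him, Set.image_comp]
            congr 1
            ext i
            rw [Equiv.image_eq_preimage_symm, Set.mem_preimage, Equiv.symm_swap, Set.mem_Iio,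
              Set.mem_Iio, Equiv.swap_apply_def]
            split_ifs <;> omega
          · simp only [Function.comp]
            rw [Equiv.swap_apply_of_ne_of_ne (by omega) (by omega), Equiv.swap_apply_def]
            split_ifs with h1 h2
            · exact hlt a ha l hl (by omega)
            · exact hlt a ha k hk (by omega)
            · exact hlt a ha b hb hab
          · simp only [Function.comp, Equiv.swap_apply_left]
            rcases Nat.lt_succ_iff_lt_or_eq.1 hbl with h5 | rfl
            · rw [Equiv.swap_apply_of_ne_of_ne (by omega) (by omega)]
              exact hc.trans (hltk b hb hkb h5)
            · simpa using hc
          · rcases Nat.lt_succ_iff_lt_or_eq.1 hbl with h5 | rfl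
            · exact hltk b hb hkb h5
            · refine lt_of_le_of_ne (not_lt.1 hc) fun h => ?_
              have := hinj (show k ∈ Set.Iio n from hk) (show b ∈ Set.Iio n from hb) h
              omega
        · have := Nat.mul_le_mul_right (35 + 8) (Nat.sub_le n (k + 1))
          omega
        · rintro s₁ ⟨z, hs', hz, hinj, him, hlt, hltk⟩
          refine ⟨z, hs', hz, hinj, him, fun a ha b hb hab => ?_, fun b _ _ _ => by omega⟩
          rcases Nat.lt_succ_iff_lt_or_eq.1 ha with h5 | rfl
          · exact hlt a h5 b hb hab
          · exact hltk b hb hab hb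
      · simp only [Prog.time, IExpr.cost, Nat.pow_one]
        omega
  refine key.frame.mono ?_ ?_
  · exact (loop_time (n + 1) 60 1 (by omega)).trans (Nat.mul_le_mul_right _ (by omega))
  · rintro s ⟨⟨y', hs, hy', hinj, him, hlt, -⟩, hf⟩
    refine ⟨y', ⟨(hf.ireg 0 (by decide)).trans hg.n_eq, (hf.ireg 1 (by decide)).trans hg.nn_eq,
      fun i hi => ?_, hy'⟩, fun a ha b hb hab => hlt a ha b hb hab, him,
      fun a ha => hs a (.inr ha)⟩
    rw [hs i (.inl hi), hg.x_eq i hi]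

theorem ends_findSize (hn : 1 ≤ n) {A B : Set ℝ} (hg : HasGrid n A B s₀)
    (h15 : s₀.ireg 15 = n + 1) :
    Ends (lim n) findSize s₀ (1600 * (n + 1) ^ 4) (fun s => ∃ x y, Grid n x y s ∧
      Set.InjOn x (Set.Iio n) ∧ StrictMonoOn y (Set.Iio n) ∧ x '' Set.Iio n = B ∧
      y '' Set.Iio n = Neg.neg '' A ∧ IsLast n x y (s.ireg 3) (s.ireg 4) ∧
      ∀ a, 2 * n + 2 * (n * n) ≤ a → s.rmem a = s₀.rmem a) := by
  obtain ⟨x, y, hg, hx, hy, rfl, rfl⟩ := hg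
  refine (Ends.seq_of (T' := 100 * (n + 1) ^ 2 + 1400 * (n + 1) ^ 4) (ends_rotGrid hg) ?_).mono ?_
    fun _ => id
  · rintro s₁ ⟨hg₁, hs₁⟩ hf₁
    refine Ends.seq_of (ends_sortRows hg₁ fun i hi j hj hij => hx hi hj (neg_injective hij)) ?_
    rintro s₂ ⟨y', hg₂, hy', him, hs₂⟩ hf₂
    have e15 : s₂.ireg 15 = n + 1 := by
      rw [hf₂.ireg 15 (by decide), hf₁.ireg 15 (by decide), h15]
    refine (ends_sizePass hn hy' hg₂ e15).frame.mono le_rfl ?_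
    rintro s ⟨⟨hs, hl⟩, hf⟩
    refine ⟨y, y', ⟨(hf.ireg 0 (by decide)).trans hg₂.n_eq,
      (hf.ireg 1 (by decide)).trans hg₂.nn_eq, fun i hi => ?_, fun j hj => ?_⟩, hy, hy', rfl, ?_,
      hl, fun a ha => ?_⟩
    · rw [hs _ (.inl (by omega)), hg₂.x_eq i hi]
    · rw [hs _ (.inl (by omega)), hg₂.y_eq j hj]
    · rw [him, Set.image_image]
    · rw [hs a (.inr ha), hs₂ a (by omega), hs₁ a (by omega)]
  · have h1 : (n + 1) ^ 2 ≤ (n + 1) ^ 4 := Nat.pow_le_pow_right (by omega) (by omega)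
    omega

end

/-! ### The algorithm for the maximum size -/

def init : Prog :=
  .seq (.setIReg 1 (.mul (.reg 0) (.reg 0))) (.seq (.setIReg 14 (.const 4))
    (.setIReg 15 (.add (.reg 0) (.const 1))))

/-- The grid is turned before each search, so the searches see turns 1 to 4, and the last one sees
the original grid. -/
def sizeProg : Prog :=
  .seq init (.seq (forLoop 11 14 (.seq findSize
    (.ite (.ilt (.reg 2) (.reg 3)) (.setIReg 2 (.reg 3)) .skip))) (.setIReg 0 (.reg 2)))

section
variable {n : ℕ}

theorem hasGrid_input {X Y : Fin n → ℝ} (hX : Function.Injective X) (hY : Function.Injective Y)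
    {s : State} (h0 : s.ireg 0 = n) (h1 : s.ireg 1 = n * n)
    (hs : s.rmem = (gridInput X Y).rmem) : HasGrid n (Set.range X) (Set.range Y) s := by
  have hxv (i : Fin n) : s.rmem i = X i := by simp [hs, gridInput]
  have hyv (i : Fin n) : s.rmem (n + i) = Y i := by simp [hs, gridInput]
  refine ⟨fun i => s.rmem i, fun i => s.rmem (n + i), ⟨h0, h1, fun _ _ => rfl, fun _ _ => rfl⟩,
    fun i hi j hj hij => ?_, fun i hi j hj hij => ?_, ?_, ?_⟩
  · have h : X ⟨i, hi⟩ = X ⟨j, hj⟩ := by rw [← hxv, ← hxv]; exact hij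
    exact congrArg Fin.val (hX h)
  · have h : Y ⟨i, hi⟩ = Y ⟨j, hj⟩ := by rw [← hyv, ← hyv]; exact hij
    exact congrArg Fin.val (hY h)
  · ext t
    constructor
    · rintro ⟨i, hi, rfl⟩
      exact ⟨⟨i, hi⟩, (hxv ⟨i, hi⟩).symm⟩
    · rintro ⟨i, rfl⟩
      exact ⟨i, i.2, hxv i⟩
  · ext t
    constructor
    · rintro ⟨i, hi, rfl⟩
      exact ⟨⟨i, hi⟩, (hyv ⟨i, hi⟩).symm⟩
    · rintro ⟨i, rfl⟩
      exact ⟨i, i.2, hyv i⟩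

theorem ends_init {X Y : Fin n → ℝ} (hX : Function.Injective X) (hY : Function.Injective Y) :
    Ends (lim n) init (gridInput X Y) 20 (fun s => HasGrid n (Set.range X) (Set.range Y) s ∧
      s.ireg 14 = 4 ∧ s.ireg 15 = n + 1 ∧ s.ireg 2 = 0) := by
  refine (Ends.of_wp ?_).mono (by decide) fun _ => id
  have h0 : (gridInput X Y).ireg 0 = n := by simp [gridInput]
  simp only [init, Prog.wp, IExpr.Safe, IExpr.val, lim, h0, true_and]
  refine ⟨by omega, by omega, ⟨by omega, by simp [h0]; omega⟩, hasGrid_input hX hY ?_ ?_ rfl,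
    ?_, ?_, ?_⟩ <;> simp [gridInput]

theorem exists_chain_nil (A B : Set ℝ) :
    ∃ P : Fin 0 → ℝ × ℝ, IsConvexChain P ∧ Supports A B P :=
  ⟨Fin.elim0, ⟨fun i => i.elim0, .inl fun i => i.elim0, .inl fun i => i.elim0⟩,
    ⟨fun i => i.elim0, fun i => i.elim0, fun i => i.elim0⟩⟩

theorem ends_sizeProg (hn : 1 ≤ n) {X Y : Fin n → ℝ} (hX : Function.Injective X)
    (hY : Function.Injective Y) :
    Ends (lim n) sizeProg (gridInput X Y) (10000 * (n + 1) ^ 4)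
      (ReturnsMaxSize (Set.range X) (Set.range Y) (lim n)) := by
  set A := Set.range X
  set B := Set.range Y
  refine (Ends.seq_of (T' := 9000 * (n + 1) ^ 4) (ends_init hX hY) ?_).mono ?_ fun _ => id
  · rintro s₁ ⟨hg₁, h14, h15, h2⟩ hf₁
    -- A chain that attains register 2 is turned along with the grid, so it always lives in the
    -- current grid; the upper bound concerns only the turns already searched.
    refine (Ends.seq_of (T' := 2) (Ends.forLoop (B := 1610 * (n + 1) ^ 4) (m := 4) (I := fun r s =>
      HasGrid n (turn A B r).1 (turn A B r).2 s ∧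
      (∃ P : Fin (s.ireg 2) → ℝ × ℝ, IsConvexChain P ∧
        Supports (turn A B r).1 (turn A B r).2 P) ∧
      ∀ r', 1 ≤ r' → r' ≤ r → IncBound (turn A B r').1 (turn A B r').2 (s.ireg 2))
      (by decide) (by decide) (by decide) (by simp only [lim]; omega) h14 ?_ ?_) ?_).mono ?_
      fun _ => id
    · obtain ⟨x, y, hg, h⟩ := hg₁
      refine ⟨⟨x, y, ⟨by simpa using hg.n_eq, by simpa using hg.nn_eq, hg.x_eq, hg.y_eq⟩, h⟩, ?_,
        fun r' h1 h2 => by omega⟩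
      have e : Function.update s₁.ireg 11 0 2 = 0 := by simpa using h2
      simp only
      rw [e]
      exact exists_chain_nil _ _
    · rintro r s hr h11 h14' hf ⟨hg, ⟨P, hP, hS⟩, hb⟩
      have e15 : s.ireg 15 = n + 1 := (hf.ireg 15 (by decide)).trans h15
      refine (Ends.seq_of (T' := 10) (ends_findSize hn hg e15) ?_).mono ?_ fun _ => id
      · rintro s₃ ⟨x, y, hg₃, hx, hy, hA, hB, hl, -⟩ hf₃
        refine (Ends.of_wp ?_).mono (by decide) fun _ => id
        have hchain := chainOf_spec hy hl.q_lt hl.ne_zero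
        have hinc := hl.incBound hy
        rw [hA, hB] at hchain hinc
        have hP' := hP.rot
        have hS' := hS.rot
        have e2 : s₃.ireg 2 = s.ireg 2 := hf₃.ireg 2 (by decide)
        refine ⟨⟨trivial, trivial⟩, fun hc => ⟨trivial, ⟨x, y, ⟨?_, ?_, hg₃.x_eq, hg₃.y_eq⟩, hx,
          hy.injOn, hA, hB⟩, ?_, ?_⟩, fun hc => ⟨⟨x, y, ⟨?_, ?_, hg₃.x_eq, hg₃.y_eq⟩, hx,
          hy.injOn, hA, hB⟩, ?_, ?_⟩⟩
        · simpa using hg₃.n_eq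
        · simpa using hg₃.nn_eq
        · have e : Function.update (Function.update s₃.ireg 2 (IExpr.val s₃ (.reg 3))) 11 (r + 1) 2
              = s₃.ireg 3 := by simp [IExpr.val]
          simp only
          rw [e]
          exact ⟨_, hchain⟩
        · intro r' h1 h2
          simp only [Test.Holds, IExpr.val, e2] at hc
          simp only [IExpr.val, ne_eq, Nat.reduceEqDiff, not_false_eq_true,
            Function.update_of_ne, Function.update_self]
          rcases Nat.lt_succ_iff_lt_or_eq.1 (Nat.lt_succ_of_le h2) with h3 | rfl
          · exact (hb r' h1 (by omega)).mono hc.le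
          · exact hinc
        · simpa using hg₃.n_eq
        · simpa using hg₃.nn_eq
        · have e : Function.update s₃.ireg 11 (r + 1) 2 = s.ireg 2 := by simp [e2]
          simp only
          rw [e]
          exact ⟨_, hP', hS'⟩
        · intro r' h1 h2
          simp only [Test.Holds, IExpr.val, e2] at hc
          simp only [ne_eq, Nat.reduceEqDiff, not_false_eq_true,
            Function.update_of_ne, e2]
          rcases Nat.lt_succ_iff_lt_or_eq.1 (Nat.lt_succ_of_le h2) with h3 | rfl
          · exact hb r' h1 (by omega)
          · exact hinc.mono (not_lt.1 hc)
      · have h3 : 1 ≤ (n + 1) ^ 4 := Nat.one_le_pow _ _ (by omega)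
        omega
    · rintro s₂ ⟨-, ⟨P, hP, hS⟩, hb⟩ hf₂
      refine Ends.of_wp (p := .setIReg 0 (.reg 2)) ⟨trivial, ?_⟩
      rw [turn_four] at hS
      simp only [ReturnsMaxSize, IExpr.val, Function.update_self]
      exact ⟨⟨P, hP, hS⟩, fun k ⟨P', hP', hS'⟩ => le_of_incBound hb hP' hS'⟩
    · have h3 : 1 ≤ (n + 1) ^ 4 := Nat.one_le_pow _ _ (by omega)
      omega
  · have h3 : 1 ≤ (n + 1) ^ 4 := Nat.one_le_pow _ _ (by omega)
    omega

end

/-! ### Finding the vertices of a chain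

For every point of the current table, the ancestor is the vertex of its best chain in the last
table whose number is a multiple of register `6`. A pass through all tables turns the known vertices
with numbers divisible by twice this distance into those with numbers divisible by it. -/

def knownE (e : IExpr) : IExpr := .add (.add (.reg 1) (.reg 1)) e

/-- With `k`, `h`, `K` in registers 5, 6, 3: vertex `k` is already known if `k = K` or `2h ∣ k`, and
its ancestor is the vertex with the largest number below `k` divisible by `h`. If that number is
`0`, the cell written is never consulted. -/
def learn : Prog :=
  .ite (.neg (.ilt (.reg 3) (.reg 5)))
    (.ite (.neg (.conj (.neg (.ieq (.reg 5) (.reg 3)))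
        (.neg (.ieq (.mul (.div (.reg 5) (.add (.reg 6) (.reg 6))) (.add (.reg 6) (.reg 6)))
          (.reg 5)))))
      (.setIMem (knownE (.mul (.div (.sub (.reg 5) (.const 1)) (.reg 6)) (.reg 6)))
        (.mem (.mem (knownE (.reg 5)))))
      .skip)
    .skip

/-- Must come after `learn`, which still needs the ancestors from the previous multiple of the
distance. -/
def resetAnc : Prog :=
  .ite (.ieq (.mul (.div (.reg 5) (.reg 6)) (.reg 6)) (.reg 5))
    (forLoop 12 1 (.setIMem (.reg 12) (.reg 12))) .skip

def ancPass : Prog := levels (.seq learn resetAnc)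

/-- The vertices whose numbers are divisible by `H`, and the last one, are known. -/
def Known (n : ℕ) (x y : ℕ → ℝ) (K q H : ℕ) (s : State) : Prop :=
  ∀ m, 1 ≤ m → m ≤ K → H ∣ m ∨ m = K → s.imem (2 * (n * n) + m) = vertex n x y K q m

/-- The vertices that are known before table `k` in a pass with distance `h`. -/
def KnownBelow (n : ℕ) (x y : ℕ → ℝ) (K q h k : ℕ) (s : State) : Prop :=
  Known n x y K q (2 * h) s ∧ ∀ m, 1 ≤ m → m ≤ K → h ∣ m → m + h < k ∨ K < k →
    s.imem (2 * (n * n) + m) = vertex n x y K q m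

/-- The ancestor of vertex `k` before table `k` is processed. -/
def AncEq (n : ℕ) (x y : ℕ → ℝ) (K q h k : ℕ) (α : ℕ → ℕ) : Prop :=
  k ≤ K → 1 ≤ (k - 1) / h * h → α (vertex n x y K q k) = vertex n x y K q ((k - 1) / h * h)

theorem div_mul_eq_of_dvd {h m k : ℕ} (hd : h ∣ m) (h1 : m ≤ k) (h2 : k < m + h) :
    k / h * h = m := by
  obtain ⟨c, rfl⟩ := hd
  have hpos : 0 < h := by
    rcases Nat.eq_zero_or_pos h with rfl | h0
    · omega
    · exact h0
  have : k / h = c := by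
    apply Nat.div_eq_of_lt_le
    · rwa [Nat.mul_comm]
    · rw [Nat.add_mul, Nat.mul_comm]
      omega
  rw [this, Nat.mul_comm]

/-- A multiple `m` of `h` that is not yet known is an odd multiple, so vertex `m + h`, if it exists,
is known, and `m` is learned at table `m + h`. -/
theorem two_mul_dvd_or {h m : ℕ} (hd : h ∣ m) : 2 * h ∣ m ∨ 2 * h ∣ m + h := by
  obtain ⟨c, rfl⟩ := hd
  rcases Nat.even_or_odd' c with ⟨d, rfl | rfl⟩
  · exact .inl ⟨d, by ring⟩
  · exact .inr ⟨d + 1, by ring⟩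

section
variable {n : ℕ} {x y : ℕ → ℝ} {s₀ : State} {K q h k : ℕ} {α : ℕ → ℕ}

theorem ends_learn (hy : StrictMonoOn y (Set.Iio n)) (hl : IsLast n x y K q) (hk : 1 ≤ k)
    (hkn : k ≤ n) (hh : 1 ≤ h) (hhn : h ≤ 2 * n + 2) (h1 : s₀.ireg 1 = n * n)
    (h3 : s₀.ireg 3 = K) (h5 : s₀.ireg 5 = k) (h6 : s₀.ireg 6 = h)
    (hα : ∀ p < n * n, s₀.imem p = α p) (hkn' : KnownBelow n x y K q h k s₀)
    (hanc : AncEq n x y K q h k α) :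
    Ends (lim n) learn s₀ learn.time (fun s => (∀ p < n * n, s.imem p = α p) ∧
      KnownBelow n x y K q h (k + 1) s) := by
  obtain ⟨hold, hnew⟩ := hkn'
  have hnn := Nat.le_mul_self n
  have two : n * n + n * n = 2 * (n * n) := by omega
  have twoh : h + h = 2 * h := by omega
  have hd1 := Nat.div_mul_le_self k (2 * h)
  have hd2 := Nat.div_mul_le_self (k - 1) h
  have hd3 := Nat.div_le_self k (2 * h)
  have hd4 := Nat.div_le_self (k - 1) h
  have hdvd : k / (2 * h) * (2 * h) = k ↔ 2 * h ∣ k :=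
    ⟨fun e => ⟨_, by rw [Nat.mul_comm]; exact e.symm⟩, fun e => Nat.div_mul_cancel e⟩
  refine Ends.of_wp ?_
  simp only [learn, knownE, Prog.wp, Test.Safe, Test.Holds, IExpr.Safe, IExpr.val, h1, h3, h5, h6,
    lim, true_and, and_true, two, twoh, not_lt, not_and_or, not_not, hdvd]
  refine ⟨fun hkK => ⟨fun _ => by omega, fun hc => ?_,
    fun hc => ⟨hα, hold, fun m hm hmK hd hc' => ?_⟩⟩,
    fun hkK => ⟨hα, hold, fun m hm hmK hd hc' => hnew m hm hmK hd (.inr (by omega))⟩⟩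
  · have hv := hold k hk hkK hc.symm
    have hvlt := (vertex_spec hy hl.q_lt hl.ne_zero hk hkK).1
    rw [hv, hα _ hvlt]
    refine ⟨by omega, by omega, by omega, fun p hp => ?_, fun m hm hmK hd => ?_,
      fun m hm hmK hd hc' => ?_⟩
    · rw [Function.update_of_ne (by omega), hα p hp]
    · simp only
      by_cases hm0 : m = (k - 1) / h * h
      · rw [hm0, Function.update_self]
        exact hanc hkK (hm0 ▸ hm)
      · rw [Function.update_of_ne (by omega), hold m hm hmK hd]
    · simp only
      by_cases hm0 : m = (k - 1) / h * h
      · rw [hm0, Function.update_self]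
        exact hanc hkK (hm0 ▸ hm)
      · rw [Function.update_of_ne (by omega)]
        by_cases hlt : m + h < k
        · exact hnew m hm hmK hd (.inl hlt)
        by_cases hmK' : m = K
        · exact hold m hm hmK (.inr hmK')
        -- A vertex that is due now lies at most `h` below `k`, and below `k` itself; only the
        -- number just learned qualifies.
        refine absurd (div_mul_eq_of_dvd hd ?_ ?_).symm hm0
        · by_contra hlt'
          omega
        · omega
  · rcases two_mul_dvd_or hd with h2 | h2
    · exact hold m hm hmK (.inl h2)
    · by_cases hlt : m + h < k
      · exact hnew m hm hmK hd (.inl hlt)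
      · have : m + h = k := by
          rcases hc' with h | h
          · omega
          · exact absurd (.inl (by omega)) hc
        rw [this] at h2
        exact absurd (.inr h2) hc

theorem ends_resetAnc (hkn : k ≤ n) (hh : 1 ≤ h) (h1 : s₀.ireg 1 = n * n)
    (h5 : s₀.ireg 5 = k) (h6 : s₀.ireg 6 = h) (hα : ∀ p < n * n, s₀.imem p = α p) :
    Ends (lim n) resetAnc s₀ (30 * (n + 1) ^ 2) (fun s =>
      (∀ p < n * n, s.imem p = if k / h * h = k then p else α p) ∧
      ∀ a, n * n ≤ a → s.imem a = s₀.imem a) := by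
  have hd2 := Nat.div_mul_le_self k h
  have hd4 := Nat.div_le_self k h
  have hpow : 1 ≤ (n + 1) ^ 2 := Nat.one_le_pow _ _ (by omega)
  refine (Ends.ite (T := 11 * (n + 1) ^ 2) ?_ (fun hc => ?_) (fun hc => ?_)).mono ?_ fun _ => id
  · simp only [Test.Safe, IExpr.Safe, IExpr.val, h5, h6, lim, true_and, and_true]
    omega
  · simp only [Test.Holds, IExpr.val, h5, h6] at hc
    refine (Ends.forLoop (B := 3) (m := n * n) (I := fun l s =>
      (∀ p < l, s.imem p = p) ∧ ∀ a, n * n ≤ a → s.imem a = s₀.imem a) (by decide) (by decide)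
      (by decide) (by simp only [lim]; omega) h1 ⟨by simp, fun _ _ => rfl⟩ ?_).mono ?_ ?_
    · rintro l s hl h12 h1' hf ⟨hs, hs'⟩
      refine (Ends.of_wp ?_).mono (by decide) fun _ => id
      simp only [Prog.wp, IExpr.Safe, IExpr.val, h12, lim, true_and]
      refine ⟨by omega, fun p hp => ?_, fun a ha => ?_⟩
      · rcases Nat.lt_succ_iff_lt_or_eq.1 hp with h5 | rfl
        · rw [Function.update_of_ne (by omega), hs p h5]
        · simp
      · rw [Function.update_of_ne (by omega), hs' a ha]
    · exact sq_loop_time n 3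
    · rintro s ⟨hs, hs'⟩
      exact ⟨fun p hp => by rw [if_pos hc, hs p hp], hs'⟩
  · simp only [Test.Holds, IExpr.val, h5, h6] at hc
    refine (Ends.of_wp (p := .skip) (Q := fun s =>
      (∀ p < n * n, s.imem p = if k / h * h = k then p else α p) ∧
      ∀ a, n * n ≤ a → s.imem a = s₀.imem a) ⟨fun p hp => ?_, fun _ _ => rfl⟩).mono ?_ fun _ => id
    · rw [if_neg hc, hα p hp]
    · simp only [Prog.time]
      omega
  · simp only [Test.cost, IExpr.cost]
    omega

theorem ends_ancPass (hy : StrictMonoOn y (Set.Iio n)) (hg : Grid n x y s₀)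
    (h15 : s₀.ireg 15 = n + 1) (hl : IsLast n x y K q) (h3 : s₀.ireg 3 = K) (h6 : s₀.ireg 6 = h)
    (hh : 1 ≤ h) (hhn : h ≤ 2 * n + 2) (hkn : Known n x y K q (2 * h) s₀) :
    Ends (lim n) ancPass s₀ (1300 * (n + 1) ^ 4) (fun s =>
      (∀ a, a < 2 * n ∨ 2 * n + 2 * (n * n) ≤ a → s.rmem a = s₀.rmem a) ∧
      Known n x y K q h s) := by
  refine (ends_levels hy hg h15 (hook := .seq learn resetAnc) (by decide) (by decide)
    (fun k α s => s.ireg 3 = K ∧ s.ireg 6 = h ∧ KnownBelow n x y K q h k s ∧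
      AncEq n x y K q h k α) ?_ ?_).mono le_rfl ?_
  · intro α s hr hm
    refine ⟨(hr 3 (by simp) (by simp)).trans h3, (hr 6 (by simp) (by simp)).trans h6,
      ⟨fun m hm1 hmK hd => ?_, fun m _ _ _ hc => ?_⟩, fun _ hc => ?_⟩
    · rw [hm _ (by omega), hkn m hm1 hmK hd]
    · have := hl.one_le
      omega
    · simp at hc
  · rintro k α s hk hk' h5 hg' ht ⟨e3, e6, hkb, hanc⟩
    refine (Ends.seq_of (T' := 30 * (n + 1) ^ 2) (ends_learn hy hl hk hk' hh hhn hg'.nn_eq e3 h5 e6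
      ht.anc hkb hanc) ?_).mono ?_ fun _ => id
    · rintro s₁ ⟨hα₁, hkb₁⟩ hf₁
      refine (ends_resetAnc hk' hh ((hf₁.ireg 1 (by decide)).trans hg'.nn_eq)
        ((hf₁.ireg 5 (by decide)).trans h5) ((hf₁.ireg 6 (by decide)).trans e6) hα₁).frame.mono
        le_rfl ?_
      rintro s₂ ⟨⟨hα₂, hm₂⟩, hf₂⟩
      refine ⟨_, hα₂, fun s β hr hm hβ => ⟨?_, ?_, ⟨fun m hm1 hmK hd => ?_,
        fun m hm1 hmK hd hc => ?_⟩, fun hkK hc => ?_⟩⟩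
      · rw [hr 3 (by decide), hf₂.ireg 3 (by decide), hf₁.ireg 3 (by decide), e3]
      · rw [hr 6 (by decide), hf₂.ireg 6 (by decide), hf₁.ireg 6 (by decide), e6]
      · rw [hm _ (by omega), hm₂ _ (by omega), hkb₁.1 m hm1 hmK hd]
      · rw [hm _ (by omega), hm₂ _ (by omega), hkb₁.2 m hm1 hmK hd hc]
      · have hv := vertex_spec hy hl.q_lt hl.ne_zero (m := k + 1) (by omega) hkK
        rw [hβ _ hv.1 hv.2, ← vertex_eq_pred (by omega)]
        rw [Nat.add_sub_cancel] at hc ⊢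
        -- If `h ∣ k`, vertex `k` has just become its own ancestor. Otherwise the last multiple of
        -- `h` up to `k` is the one below `k`, and the old ancestor is inherited.
        split_ifs with hdk
        · rw [hdk]
        · have e : k / h * h = (k - 1) / h * h := by
            have h1 := Nat.div_mul_le_self k h
            have h2 := Nat.lt_div_mul_add (a := k) (b := h) (by omega)
            exact (div_mul_eq_of_dvd (Dvd.intro_left _ rfl) (by omega) (by omega)).symm
          rw [e] at hc ⊢
          exact hanc (by omega) hc
    · have h1 : learn.time ≤ 60 := by decide
      have h2 : 1 ≤ (n + 1) ^ 3 := Nat.one_le_pow _ _ (by omega)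
      have h3 : (n + 1) ^ 2 ≤ (n + 1) ^ 3 := Nat.pow_le_pow_right (by omega) (by omega)
      omega
  · rintro s ⟨hs, α, -, -, hkb, -⟩
    refine ⟨hs, fun m hm hmK hd => ?_⟩
    rcases hd with hd | hd
    · exact hkb.2 m hm hmK hd (.inr (by have := hl.le_n; omega))
    · exact hkb.1 m hm hmK (.inr hd)

/-- The distance starts at a power of two above `n`, so the last vertex alone has to be known at the
beginning. Each pass halves it, and at distance 1 all vertices are known. -/
def rounds : Prog :=
  .seq (.setIReg 6 (.const 1)) (.seq
    (.while (.ilt (.reg 6) (.reg 15)) (.setIReg 6 (.add (.reg 6) (.reg 6)))) (.seq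
    (.setIMem (knownE (.reg 3)) (.reg 4))
    (.while (.ilt (.const 1) (.reg 6)) (.seq (.setIReg 6 (.div (.reg 6) (.const 2))) ancPass))))

theorem ends_double (h15 : s₀.ireg 15 = n + 1) (h6 : s₀.ireg 6 = 1) :
    Ends (lim n) (.while (.ilt (.reg 6) (.reg 15)) (.setIReg 6 (.add (.reg 6) (.reg 6)))) s₀
      (40 * (n + 1)) (fun s => ∃ e, e ≤ Nat.log 2 (n + 1) + 1 ∧ s.ireg 6 = 2 ^ e ∧ n < 2 ^ e ∧
        2 ^ e ≤ 2 * n + 2) := by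
  -- A value that is still to be doubled is at most `n + 1`, so the distance never exceeds `2 * n +
  -- 2` and fits into a word. The crude measure costs only linear time.
  have key := Ends.while (L := lim n) (c := .ilt (.reg 6) (.reg 15))
    (p := .setIReg 6 (.add (.reg 6) (.reg 6))) (B := 4) (I := fun m s => s.ireg 15 = n + 1 ∧
      ∃ e, e ≤ Nat.log 2 (n + 1) + 1 ∧ s.ireg 6 = 2 ^ e ∧ 2 ^ e ≤ 2 * n + 2 ∧
        m = 2 * n + 2 - 2 ^ e) (Q := fun s => ∃ e, e ≤ Nat.log 2 (n + 1) + 1 ∧ s.ireg 6 = 2 ^ e ∧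
        n < 2 ^ e ∧ 2 ^ e ≤ 2 * n + 2) ?_ ?_ ?_ (2 * n + 1) s₀ ?_
  · refine key.mono ?_ fun _ => id
    simp only [Test.cost, IExpr.cost]
    omega
  · intro m s _
    exact ⟨trivial, trivial⟩
  · rintro m s ⟨e15, e, he, e6, hle, rfl⟩ hc
    simp only [Test.Holds, IExpr.val, e15, e6] at hc
    have h1 : 1 ≤ 2 ^ e := Nat.one_le_two_pow
    have h2 : 2 ^ (e + 1) = 2 ^ e + 2 ^ e := by ring
    refine (Ends.of_wp ?_).mono (by decide) fun _ => id
    simp only [Prog.wp, IExpr.Safe, IExpr.val, e6, lim, true_and]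
    refine ⟨by omega, _, ?_, by simpa using e15, e + 1, ?_, by simp [h2], by omega, rfl⟩
    · omega
    · have := Nat.le_log_of_pow_le (b := 2) (by norm_num) hc.le
      omega
  · rintro m s ⟨e15, e, he, e6, hle, rfl⟩ hc
    simp only [Test.Holds, IExpr.val, e15, e6] at hc
    exact ⟨e, he, e6, by omega, hle⟩
  · exact ⟨h15, 0, by omega, by simpa using h6, by omega, by simp⟩

theorem ends_halve (hy : StrictMonoOn y (Set.Iio n)) (hg : Grid n x y s₀)
    (h15 : s₀.ireg 15 = n + 1) (hl : IsLast n x y K q) (h3 : s₀.ireg 3 = K) {e : ℕ}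
    (h6 : s₀.ireg 6 = 2 ^ e) (he : 2 ^ e ≤ 2 * n + 2) (hkn : Known n x y K q (2 ^ e) s₀) :
    Ends (lim n) (.while (.ilt (.const 1) (.reg 6))
      (.seq (.setIReg 6 (.div (.reg 6) (.const 2))) ancPass)) s₀
      ((e + 1) * (1310 * (n + 1) ^ 4)) (fun s =>
      (∀ a, a < 2 * n ∨ 2 * n + 2 * (n * n) ≤ a → s.rmem a = s₀.rmem a) ∧
      Known n x y K q 1 s) := by
  have hpow : 1 ≤ (n + 1) ^ 4 := Nat.one_le_pow _ _ (by omega)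
  -- The exponent of the distance is the measure, whence the logarithmic number of passes.
  have key := Ends.while (L := lim n) (c := .ilt (.const 1) (.reg 6))
    (p := .seq (.setIReg 6 (.div (.reg 6) (.const 2))) ancPass) (B := 4 + 1300 * (n + 1) ^ 4)
    (I := fun e s => (∀ r, r ∈ [0, 1, 3, 15] → s.ireg r = s₀.ireg r) ∧
      (∀ a, a < 2 * n ∨ 2 * n + 2 * (n * n) ≤ a → s.rmem a = s₀.rmem a) ∧
      s.ireg 6 = 2 ^ e ∧ 2 ^ e ≤ 2 * n + 2 ∧ Known n x y K q (2 ^ e) s)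
    (Q := fun s => (∀ a, a < 2 * n ∨ 2 * n + 2 * (n * n) ≤ a → s.rmem a = s₀.rmem a) ∧
      Known n x y K q 1 s) ?_ ?_ ?_ e s₀ ⟨fun _ _ => rfl, fun _ _ => rfl, h6, he, hkn⟩
  · refine key.mono ?_ fun _ => id
    have := Nat.mul_le_mul_left e (show 4 + 1300 * (n + 1) ^ 4 + (1 + 1 + 1) + 1 ≤
      1310 * (n + 1) ^ 4 by omega)
    simp only [Test.cost, IExpr.cost]
    rw [Nat.add_mul]
    omega
  · intro m s _
    exact ⟨by simp [IExpr.Safe, lim], trivial⟩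
  · rintro m s ⟨hr, hm, e6, hle, hkn'⟩ hc
    simp only [Test.Holds, IExpr.val, e6] at hc
    obtain ⟨m, rfl⟩ : ∃ d, m = d + 1 := ⟨m - 1, by
      rcases m with _ | m
      · simp at hc
      · omega⟩
    have h1 : 1 ≤ 2 ^ m := Nat.one_le_two_pow
    have h2 : 2 ^ (m + 1) = 2 * 2 ^ m := by ring
    have hdiv : 2 ^ (m + 1) / 2 = 2 ^ m := by omega
    refine (Ends.seq_of (Ends.of_wp (p := .setIReg 6 (.div (.reg 6) (.const 2)))
      (Q := fun s' => s' = { s with ireg := Function.update s.ireg 6 (2 ^ m) }) ⟨?_, ?_⟩)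
      (T' := 1300 * (n + 1) ^ 4) ?_).mono (le_of_eq rfl) fun _ => id
    · simp only [IExpr.Safe, IExpr.val, e6, lim, true_and, hdiv]
      omega
    · simp only [IExpr.val, e6, hdiv]
    · rintro s' rfl -
      refine (ends_ancPass (h := 2 ^ m) (s₀ := { s with ireg := Function.update s.ireg 6 (2 ^ m) })
        hy ⟨?_, ?_, fun i hi => ?_, fun j hj => ?_⟩ ?_ hl ?_ ?_ h1 (by omega) ?_).frame.mono le_rfl
        ?_
      · simpa using (hr 0 (by simp)).trans hg.n_eq
      · simpa using (hr 1 (by simp)).trans hg.nn_eq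
      · exact (hm _ (.inl (by omega))).trans (hg.x_eq i hi)
      · exact (hm _ (.inl (by omega))).trans (hg.y_eq j hj)
      · simpa using (hr 15 (by simp)).trans h15
      · simpa using (hr 3 (by simp)).trans h3
      · simp
      · rw [← h2]
        exact hkn'
      · rintro s' ⟨⟨hm', hkn''⟩, hf⟩
        refine ⟨m, by omega, fun r hr' => ?_, fun a ha => (hm' a ha).trans (hm a ha), ?_, by omega,
          hkn''⟩
        · have hr6 : r ∉ ancPass.writes ∧ r ≠ 6 := by
            simp only [List.mem_cons, List.not_mem_nil, or_false] at hr'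
            rcases hr' with rfl | rfl | rfl | rfl <;> decide
          rw [hf.ireg r hr6.1, ← hr r hr']
          simp [hr6.2]
        · rw [hf.ireg 6 (by decide)]
          simp
  · rintro m s ⟨hr, hm, e6, hle, hkn'⟩ hc
    simp only [Test.Holds, IExpr.val, e6] at hc
    have h1 : 1 ≤ 2 ^ m := Nat.one_le_two_pow
    have : 2 ^ m = 1 := by omega
    rw [this] at hkn'
    exact ⟨hm, hkn'⟩

theorem ends_rounds (hy : StrictMonoOn y (Set.Iio n)) (hg : Grid n x y s₀)
    (h15 : s₀.ireg 15 = n + 1) (hl : IsLast n x y K q) (h3 : s₀.ireg 3 = K) (h4 : s₀.ireg 4 = q) :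
    Ends (lim n) rounds s₀ ((Nat.log 2 (n + 1) + 3) * (1310 * (n + 1) ^ 4)) (fun s =>
      (∀ a, a < 2 * n ∨ 2 * n + 2 * (n * n) ≤ a → s.rmem a = s₀.rmem a) ∧
      Known n x y K q 1 s) := by
  have hnn := Nat.le_mul_self n
  have hKn := hl.le_n
  have hq := hl.q_lt
  refine (Ends.seq_of (T := 2)
    (T' := 40 * (n + 1) + (10 + (Nat.log 2 (n + 1) + 2) * (1310 * (n + 1) ^ 4))) (Ends.of_wp
    (p := .setIReg 6 (.const 1)) (Q := fun s => s = { s₀ with ireg := Function.update s₀.ireg 6 1 })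
    ⟨by simp [IExpr.Safe, lim], rfl⟩) ?_).mono ?_ fun _ => id
  · rintro s rfl -
    refine Ends.seq_of (ends_double (n := n) (by simpa using h15) (by simp)) ?_
    rintro s₁ ⟨e, he, h6, hlt, hle⟩ hf₁
    have hr : ∀ r, r ≠ 6 → s₁.ireg r = s₀.ireg r := fun r hr => by
      rw [hf₁.ireg r (by simpa [Prog.writes] using hr)]
      simp [hr]
    have hm₁ : s₁.rmem = s₀.rmem := hf₁.rmem (by decide)
    have e1 := (hr 1 (by decide)).trans hg.nn_eq
    have e3 := (hr 3 (by decide)).trans h3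
    have e4 := (hr 4 (by decide)).trans h4
    refine Ends.seq_of (T := 10) ((Ends.of_wp (p := .setIMem (knownE (.reg 3)) (.reg 4))
      (Q := fun s => s = { s₁ with imem := Function.update s₁.imem (2 * (n * n) + K) q })
      ?_).mono (by decide) fun _ => id) ?_
    · simp only [Prog.wp, knownE, IExpr.Safe, IExpr.val, e1, e3, e4, lim, true_and]
      have two : n * n + n * n = 2 * (n * n) := by omega
      rw [two]
      exact ⟨by omega, by omega, rfl⟩
    · rintro s rfl -
      refine (ends_halve (e := e) (K := K) (q := q)
        (s₀ := { s₁ with imem := Function.update s₁.imem (2 * (n * n) + K) q }) hy ⟨?_, e1,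
          fun i hi => ?_, fun j hj => ?_⟩ ((hr 15 (by decide)).trans h15) hl e3 h6 hle
          fun m hm hmK hd => ?_).mono ?_ ?_
      · exact (hr 0 (by decide)).trans hg.n_eq
      · simp only [hm₁, hg.x_eq i hi]
      · simp only [hm₁, hg.y_eq j hj]
      -- No number from 1 to `K` is divisible by `2 ^ e`, which exceeds `n`.
      · have : m = K := by
          rcases hd with hd | hd
          · have := Nat.le_of_dvd (by omega) hd
            omega
          · exact hd
        rw [this, vertex_self]
        simp
      · exact Nat.mul_le_mul_right _ (by omega)
      · rintro s ⟨hs, hkn⟩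
        refine ⟨fun a ha => ?_, hkn⟩
        rw [hs a ha]
        simp only [hm₁]
  · have h1 : (n + 1) ^ 1 ≤ (n + 1) ^ 4 := Nat.pow_le_pow_right (by omega) (by omega)
    rw [Nat.pow_one] at h1
    rw [show Nat.log 2 (n + 1) + 3 = Nat.log 2 (n + 1) + 2 + 1 from rfl,
      Nat.add_mul (Nat.log 2 (n + 1) + 2) 1]
    omega

end

/-! ### The algorithm for a maximum chain -/

/-- Address of the `x`-coordinate of a vertex of the best chain. -/
def bestE (e : IExpr) : IExpr :=
  .add (.add (.add (.reg 0) (.reg 0)) (.add (.reg 1) (.reg 1))) (.add e e)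

/-- The chain `P` is stored as the best chain. -/
def Stored (n : ℕ) {k : ℕ} (P : Fin k → ℝ × ℝ) (s : State) : Prop :=
  ∀ i : Fin k, s.rmem (2 * n + 2 * (n * n) + 2 * i) = (P i).1 ∧
    s.rmem (2 * n + 2 * (n * n) + 2 * i + 1) = (P i).2

/-- Keeps the best chain so far inside the current grid when the grid is turned; after the fourth
turn it is a chain of the original grid. -/
def rotBest : Prog :=
  forLoop 12 2 (.seq (.setRReg 0 (.mem (bestE (.reg 12)))) (.seq
    (.setRMem (bestE (.reg 12)) (.mem (.add (bestE (.reg 12)) (.const 1))))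
    (.setRMem (.add (bestE (.reg 12)) (.const 1)) (.sub (.const 0) (.reg 0)))))

def copyChain : Prog :=
  forLoop 12 3 (.seq (.setIReg 13 (.mem (knownE (.add (.reg 12) (.const 1))))) (.seq
    (.setRMem (bestE (.reg 12)) (.mem (.div (.reg 13) (.reg 0))))
    (.setRMem (.add (bestE (.reg 12)) (.const 1))
      (.mem (yE (.sub (.reg 13) (.mul (.div (.reg 13) (.reg 0)) (.reg 0))))))))

def improve : Prog :=
  .ite (.ilt (.reg 2) (.reg 3)) (.seq rounds (.seq copyChain (.setIReg 2 (.reg 3)))) .skip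

/-- The chain has at most `n` vertices and is stored from cell `2 * n + 2 * (n * n)` on, so source
and target of the copy do not overlap. -/
def output : Prog :=
  .seq (.setIReg 13 (.add (.reg 2) (.reg 2))) (.seq
    (forLoop 12 13 (.setRMem (.reg 12)
      (.mem (.add (.add (.add (.reg 0) (.reg 0)) (.add (.reg 1) (.reg 1))) (.reg 12)))))
    (.setIReg 0 (.reg 2)))

def chainProg : Prog :=
  .seq init (.seq (forLoop 11 14 (.seq rotBest (.seq findSize improve))) output)

section
variable {n : ℕ} {x y : ℕ → ℝ} {s₀ : State}

theorem ends_rotBest {k : ℕ} {P : Fin k → ℝ × ℝ} (h0 : s₀.ireg 0 = n) (h1 : s₀.ireg 1 = n * n)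
    (h2 : s₀.ireg 2 = k) (hk : k ≤ n) (hP : Stored n P s₀) :
    Ends (lim n) rotBest s₀ (100 * (n + 1)) (fun s => Stored n (fun i => rot (P i)) s ∧
      ∀ a, a < 2 * n + 2 * (n * n) → s.rmem a = s₀.rmem a) := by
  have hnn := Nat.le_mul_self n
  refine (Ends.forLoop (B := 80) (m := k) (I := fun l s =>
    (∀ a, a < 2 * n + 2 * (n * n) → s.rmem a = s₀.rmem a) ∧
    ∀ i : Fin k, if (i : ℕ) < l then
        s.rmem (2 * n + 2 * (n * n) + 2 * i) = (P i).2 ∧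
        s.rmem (2 * n + 2 * (n * n) + 2 * i + 1) = -(P i).1
      else s.rmem (2 * n + 2 * (n * n) + 2 * i) = (P i).1 ∧
        s.rmem (2 * n + 2 * (n * n) + 2 * i + 1) = (P i).2) (by decide) (by decide) (by decide)
    (by simp only [lim]; omega) h2 ⟨fun _ _ => rfl, fun i => ?_⟩ ?_).mono ?_ ?_
  · rw [if_neg (Nat.not_lt_zero _)]
    exact hP i
  · rintro l s hl h12 h2' hf ⟨hs, hi⟩
    have e0 := (hf.ireg 0 (by decide)).trans h0
    have e1 := (hf.ireg 1 (by decide)).trans h1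
    have two : n + n + (n * n + n * n) + (l + l) = 2 * n + 2 * (n * n) + 2 * l := by omega
    have hil := hi ⟨l, hl⟩
    rw [if_neg (lt_irrefl _)] at hil
    refine (Ends.of_wp ?_).mono (by decide) fun _ => id
    simp only [Prog.wp, IExpr.Safe, IExpr.val, RExpr.Safe, RExpr.val, bestE, e0, e1, h12, lim,
      true_and, and_true, two, hil, Rat.cast_zero, zero_sub]
    refine ⟨by omega, by omega, by omega, by omega, by omega, by omega, fun a ha => ?_,
      fun i => ?_⟩
    · rw [Function.update_of_ne (by omega), Function.update_of_ne (by omega), hs a ha]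
    · by_cases hlt : (i : ℕ) = l
      · obtain rfl : i = ⟨l, hl⟩ := Fin.ext hlt
        rw [if_pos (Nat.lt_succ_self l)]
        simp only [Function.update_self, and_true]
        rw [Function.update_of_ne (by omega), Function.update_self]
      · rw [Function.update_of_ne (by omega), Function.update_of_ne (by omega),
          Function.update_of_ne (by omega), Function.update_of_ne (by omega)]
        have := hi i
        split_ifs at this ⊢ with h3 h4 h4
        · exact this
        · omega
        · omega
        · exact this
  · have := Nat.mul_le_mul_right (80 + 8) (show k + 1 ≤ n + 1 by omega)
    omega
  · rintro s ⟨hs, hi⟩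
    refine ⟨fun i => ?_, hs⟩
    have := hi i
    rwa [if_pos i.2] at this

theorem ends_copyChain {K q : ℕ} (hy : StrictMonoOn y (Set.Iio n)) (hg : Grid n x y s₀)
    (hl : IsLast n x y K q) (h3 : s₀.ireg 3 = K) (hkn : Known n x y K q 1 s₀) :
    Ends (lim n) copyChain s₀ (100 * (n + 1)) (fun s => Stored n (chainOf n x y K q) s ∧
      ∀ a, a < 2 * n + 2 * (n * n) → s.rmem a = s₀.rmem a) := by
  have hnn := Nat.le_mul_self n
  have hKn := hl.le_n
  refine (Ends.forLoop (B := 80) (m := K) (I := fun l s =>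
    (∀ a, a < 2 * n + 2 * (n * n) → s.rmem a = s₀.rmem a) ∧
    ∀ i : Fin K, (i : ℕ) < l →
      s.rmem (2 * n + 2 * (n * n) + 2 * i) = (chainOf n x y K q i).1 ∧
      s.rmem (2 * n + 2 * (n * n) + 2 * i + 1) = (chainOf n x y K q i).2) (by decide) (by decide)
    (by decide) (by simp only [lim]; omega) h3 ⟨fun _ _ => rfl, fun i hi => by omega⟩ ?_).mono
    ?_ ?_
  · rintro l s hlK h12 h3' hf ⟨hs, hi⟩
    have e0 := (hf.ireg 0 (by decide)).trans hg.n_eq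
    have e1 := (hf.ireg 1 (by decide)).trans hg.nn_eq
    have two : n + n + 2 * (n * n) + (l + l) = 2 * n + 2 * (n * n) + 2 * l := by omega
    have two' : n * n + n * n = 2 * (n * n) := by omega
    have hv : s.imem (2 * (n * n) + (l + 1)) = vertex n x y K q (l + 1) := by
      rw [hf.imem (by decide)]
      exact hkn (l + 1) (by omega) hlK (.inl (one_dvd _))
    have hvl := (vertex_spec hy hl.q_lt hl.ne_zero (m := l + 1) (by omega) hlK).1
    have hmod : vertex n x y K q (l + 1) - vertex n x y K q (l + 1) / n * n =
        vertex n x y K q (l + 1) % n := by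
      have := div_add_mod_eq (n := n) (vertex n x y K q (l + 1))
      omega
    have hd := div_lt_of_lt_sq hvl
    have hm := mod_lt_of_lt_sq hvl
    have hdm := Nat.div_mul_le_self (vertex n x y K q (l + 1)) n
    have hx : s.rmem (vertex n x y K q (l + 1) / n) = x (vertex n x y K q (l + 1) / n) := by
      rw [hs _ (by omega), hg.x_eq _ hd]
    have hy' : s.rmem (n + vertex n x y K q (l + 1) % n) = y (vertex n x y K q (l + 1) % n) := by
      rw [hs _ (by omega), hg.y_eq _ hm]
    refine (Ends.of_wp ?_).mono (by decide) fun _ => id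
    simp only [Prog.wp, IExpr.Safe, IExpr.val, RExpr.Safe, RExpr.val, bestE, knownE, yE, e0, e1,
      h12, lim, true_and, two', ne_eq, OfNat.zero_ne_ofNat, OfNat.one_ne_ofNat,
      not_false_eq_true, Function.update_of_ne, Function.update_self, Nat.reduceEqDiff, hv, hmod,
      hx, two]
    have hy'' : Function.update s.rmem (2 * n + 2 * (n * n) + 2 * l)
        (x (vertex n x y K q (l + 1) / n)) (n + vertex n x y K q (l + 1) % n) =
        y (vertex n x y K q (l + 1) % n) := by
      rw [Function.update_of_ne (by omega), hy']
    rw [hy'']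
    refine ⟨by omega, by omega, by omega, by omega, by omega, by omega, by omega,
      fun a ha => ?_, fun i hil => ?_⟩
    · rw [Function.update_of_ne (by omega), Function.update_of_ne (by omega), hs a ha]
    · by_cases hlt : (i : ℕ) = l
      · obtain rfl : i = ⟨l, hlK⟩ := Fin.ext hlt
        simp only [chainOf]
        refine ⟨?_, ?_⟩
        · rw [Function.update_of_ne (by omega), Function.update_self]
        · rw [Function.update_self]
      · rw [Function.update_of_ne (by omega), Function.update_of_ne (by omega),
          Function.update_of_ne (by omega), Function.update_of_ne (by omega)]
        exact hi i (by omega)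
  · have := Nat.mul_le_mul_right (80 + 8) (show K + 1 ≤ n + 1 by omega)
    omega
  · rintro s ⟨hs, hi⟩
    exact ⟨fun i => hi i i.2, hs⟩

theorem ends_output {k : ℕ} {P : Fin k → ℝ × ℝ} (h0 : s₀.ireg 0 = n) (h1 : s₀.ireg 1 = n * n)
    (h2 : s₀.ireg 2 = k) (hk : k ≤ n) (hP : Stored n P s₀) :
    Ends (lim n) output s₀ (100 * (n + 1)) (fun s => s.ireg 0 = k ∧
      ∀ i : Fin k, s.rmem (2 * i) = (P i).1 ∧ s.rmem (2 * i + 1) = (P i).2) := by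
  have hnn := Nat.le_mul_self n
  refine (Ends.seq_of (T := 4) (T' := (2 * k + 1) * (20 + 8) + 2) (Ends.of_wp
    (p := .setIReg 13 (.add (.reg 2) (.reg 2)))
    (Q := fun s => s = { s₀ with ireg := Function.update s₀.ireg 13 (2 * k) }) ⟨?_, ?_⟩)
    ?_).mono ?_ fun _ => id
  · simp only [IExpr.Safe, IExpr.val, h2, lim, true_and]
    omega
  · simp only [IExpr.val, h2, two_mul]
  · rintro s rfl -
    refine Ends.seq_of (Ends.forLoop (B := 20) (m := 2 * k) (I := fun l s =>
      (∀ a, 2 * n + 2 * (n * n) ≤ a → s.rmem a = s₀.rmem a) ∧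
      ∀ a < l, s.rmem a = s₀.rmem (2 * n + 2 * (n * n) + a)) (by decide) (by decide) (by decide)
      (by simp only [lim]; omega) (by simp) ⟨fun _ _ => rfl, by simp⟩ ?_) ?_
    · rintro l s hl h12 h13 hf ⟨hs, hi⟩
      have e0 : s.ireg 0 = n := (hf.ireg 0 (by decide)).trans (by simpa using h0)
      have e1 : s.ireg 1 = n * n := (hf.ireg 1 (by decide)).trans (by simpa using h1)
      have two : n + n + (n * n + n * n) + l = 2 * n + 2 * (n * n) + l := by omega
      refine (Ends.of_wp ?_).mono (by decide) fun _ => id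
      simp only [Prog.wp, IExpr.Safe, IExpr.val, RExpr.Safe, RExpr.val, e0, e1, h12, lim,
        true_and, two]
      refine ⟨by omega, by omega, fun a ha => ?_, fun a ha => ?_⟩
      · rw [Function.update_of_ne (by omega), hs a ha]
      · rcases Nat.lt_succ_iff_lt_or_eq.1 ha with h5 | rfl
        · rw [Function.update_of_ne (by omega), hi a h5]
        · rw [Function.update_self, hs _ (by omega)]
    · rintro s ⟨-, hi⟩ hf
      have e2 : s.ireg 2 = k := (hf.ireg 2 (by decide)).trans (by simpa using h2)
      refine Ends.of_wp (p := .setIReg 0 (.reg 2)) ⟨trivial, by simp [IExpr.val, e2], fun i => ?_⟩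
      have := i.2
      simp only
      rw [hi _ (by omega), hi _ (by omega)]
      exact hP i
  · omega

theorem ends_improve {A B : Set ℝ} {k : ℕ} {P : Fin k → ℝ × ℝ} (hP : IsConvexChain P)
    (hS : Supports A B P) (hst : Stored n P s₀) (h2 : s₀.ireg 2 = k) (hk : k ≤ n)
    (hg : Grid n x y s₀) (hx : Set.InjOn x (Set.Iio n)) (hy : StrictMonoOn y (Set.Iio n))
    (hA : x '' Set.Iio n = A) (hB : y '' Set.Iio n = B)
    (hl : IsLast n x y (s₀.ireg 3) (s₀.ireg 4)) (h15 : s₀.ireg 15 = n + 1) :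
    Ends (lim n) improve s₀ ((Nat.log 2 (n + 1) + 3) * (1310 * (n + 1) ^ 4) + 200 * (n + 1))
      (fun s => HasGrid n A B s ∧ ∃ (k' : ℕ) (P' : Fin k' → ℝ × ℝ), IsConvexChain P' ∧
        Supports A B P' ∧ Stored n P' s ∧ s.ireg 2 = k' ∧ k' ≤ n ∧ k ≤ k' ∧ IncBound A B k') := by
  have hinc := hl.incBound hy
  rw [hA, hB] at hinc
  refine (Ends.ite (T := (Nat.log 2 (n + 1) + 3) * (1310 * (n + 1) ^ 4) + (100 * (n + 1) + 2))
    ?_ (fun hc => ?_) (fun hc => ?_)).mono ?_ fun _ => id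
  · exact ⟨trivial, trivial⟩
  · simp only [Test.Holds, IExpr.val, h2] at hc
    refine Ends.seq_of (ends_rounds hy hg h15 hl rfl rfl) ?_
    rintro s₁ ⟨hs₁, hkn⟩ hf₁
    have hg₁ : Grid n x y s₁ := ⟨(hf₁.ireg 0 (by decide)).trans hg.n_eq,
      (hf₁.ireg 1 (by decide)).trans hg.nn_eq,
      fun i hi => (hs₁ _ (.inl (by omega))).trans (hg.x_eq i hi),
      fun i hi => (hs₁ _ (.inl (by omega))).trans (hg.y_eq i hi)⟩
    refine Ends.seq_of (ends_copyChain hy hg₁ hl (hf₁.ireg 3 (by decide)) hkn) ?_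
    rintro s₂ ⟨hst₂, hs₂⟩ hf₂
    have hg₂ : Grid n x y s₂ := ⟨(hf₂.ireg 0 (by decide)).trans hg₁.n_eq,
      (hf₂.ireg 1 (by decide)).trans hg₁.nn_eq,
      fun i hi => (hs₂ _ (by omega)).trans (hg₁.x_eq i hi),
      fun i hi => (hs₂ _ (by omega)).trans (hg₁.y_eq i hi)⟩
    have hchain := chainOf_spec hy hl.q_lt hl.ne_zero
    rw [hA, hB] at hchain
    have e3 : s₂.ireg 3 = s₀.ireg 3 := (hf₂.ireg 3 (by decide)).trans (hf₁.ireg 3 (by decide))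
    refine Ends.of_wp (p := .setIReg 2 (.reg 3)) ⟨trivial, ⟨x, y, ⟨?_, ?_, hg₂.x_eq, hg₂.y_eq⟩,
      hx, hy.injOn, hA, hB⟩, _, _, hchain.1, hchain.2, hst₂, ?_, hl.le_n, hc.le, hinc⟩
    · simpa using hg₂.n_eq
    · simpa using hg₂.nn_eq
    · simpa [IExpr.val] using e3
  · simp only [Test.Holds, IExpr.val, h2] at hc
    refine (Ends.of_wp (p := .skip) (Q := fun s => HasGrid n A B s ∧ ∃ (k' : ℕ)
      (P' : Fin k' → ℝ × ℝ), IsConvexChain P' ∧ Supports A B P' ∧ Stored n P' s ∧ s.ireg 2 = k' ∧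
      k' ≤ n ∧ k ≤ k' ∧ IncBound A B k') ⟨⟨x, y, hg, hx, hy.injOn, hA, hB⟩, k, P, hP, hS, hst, h2,
      hk, le_rfl, hinc.mono (not_lt.1 hc)⟩).mono ?_ fun _ => id
    simp only [Prog.time]
    omega
  · simp only [Test.cost, IExpr.cost]
    omega

theorem ends_chainProg (hn : 1 ≤ n) {X Y : Fin n → ℝ} (hX : Function.Injective X)
    (hY : Function.Injective Y) :
    Ends (lim n) chainProg (gridInput X Y) ((Nat.log 2 (n + 1) + 3) * (20000 * (n + 1) ^ 4))
      (ReturnsMaxChain (Set.range X) (Set.range Y) (lim n)) := by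
  set A := Set.range X
  set B := Set.range Y
  have hnn := Nat.le_mul_self n
  have hpow : (n + 1) ^ 1 ≤ (n + 1) ^ 4 := Nat.pow_le_pow_right (by omega) (by omega)
  rw [Nat.pow_one] at hpow
  refine (Ends.seq_of (T' := (Nat.log 2 (n + 1) + 3) * (16000 * (n + 1) ^ 4)) (ends_init hX hY)
    ?_).mono ?_ fun _ => id
  · rintro s₁ ⟨hg₁, h14, h15, h2⟩ hf₁
    -- The logarithmic summand pays for `rounds`; `1900` collects 100 for `rotBest`, 1600 for
    -- `findSize` and 200 for the rest of `improve`.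
    refine (Ends.seq_of (T' := 100 * (n + 1)) (Ends.forLoop
      (B := (Nat.log 2 (n + 1) + 3) * (1310 * (n + 1) ^ 4) + 1900 * (n + 1) ^ 4)
      (m := 4) (I := fun r s => HasGrid n (turn A B r).1 (turn A B r).2 s ∧
      ∃ (k : ℕ) (P : Fin k → ℝ × ℝ), IsConvexChain P ∧
        Supports (turn A B r).1 (turn A B r).2 P ∧ Stored n P s ∧ s.ireg 2 = k ∧ k ≤ n ∧
        ∀ r', 1 ≤ r' → r' ≤ r → IncBound (turn A B r').1 (turn A B r').2 k)
      (by decide) (by decide) (by decide) (by simp only [lim]; omega) h14 ?_ ?_) ?_).mono ?_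
      fun _ => id
    · obtain ⟨x, y, hg, h⟩ := hg₁
      obtain ⟨P, hP, hS⟩ := exists_chain_nil A B
      exact ⟨⟨x, y, ⟨by simpa using hg.n_eq, by simpa using hg.nn_eq, hg.x_eq, hg.y_eq⟩, h⟩, 0, P,
        hP, hS, fun i => i.elim0, by simpa using h2, by omega, fun r' h1 h2 => by omega⟩
    · rintro r s hr h11 h14' hf ⟨hg, k, P, hP, hS, hst, h2, hk, hb⟩
      obtain ⟨x, y, hg, hinj⟩ := hg
      have e15 : s.ireg 15 = n + 1 := (hf.ireg 15 (by decide)).trans h15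
      refine (Ends.seq_of (ends_rotBest hg.n_eq hg.nn_eq h2 hk hst) (T' := 1600 * (n + 1) ^ 4 +
        ((Nat.log 2 (n + 1) + 3) * (1310 * (n + 1) ^ 4) + 200 * (n + 1))) ?_).mono ?_ fun _ => id
      · rintro s₂ ⟨hst₂, hs₂⟩ hf₂
        have hg₂ : HasGrid n (turn A B r).1 (turn A B r).2 s₂ := ⟨x, y,
          ⟨(hf₂.ireg 0 (by decide)).trans hg.n_eq, (hf₂.ireg 1 (by decide)).trans hg.nn_eq,
          fun i hi => (hs₂ _ (by omega)).trans (hg.x_eq i hi),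
          fun i hi => (hs₂ _ (by omega)).trans (hg.y_eq i hi)⟩, hinj⟩
        have e15₂ := (hf₂.ireg 15 (by decide)).trans e15
        refine Ends.seq_of (ends_findSize hn hg₂ e15₂) ?_
        rintro s₃ ⟨x, y, hg₃, hx, hy, hA, hB, hl, hs₃⟩ hf₃
        have e2 : s₃.ireg 2 = k :=
          (hf₃.ireg 2 (by decide)).trans ((hf₂.ireg 2 (by decide)).trans h2)
        have hst₃ : Stored n (fun i => rot (P i)) s₃ := fun i => by
          rw [hs₃ _ (by omega), hs₃ _ (by omega)]
          exact hst₂ i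
        refine (ends_improve hP.rot hS.rot hst₃ e2 hk hg₃ hx hy hA hB hl
          ((hf₃.ireg 15 (by decide)).trans e15₂)).mono le_rfl ?_
        rintro s₄ ⟨⟨x, y, hg₄, h₄⟩, k', P', hP', hS', hst', e2', hk', hkk', hinc⟩
        refine ⟨⟨x, y, ⟨by simpa using hg₄.n_eq, by simpa using hg₄.nn_eq, hg₄.x_eq, hg₄.y_eq⟩,
          h₄⟩, k', P', hP', hS', hst', by simpa using e2', hk', fun r' h1 h2 => ?_⟩
        rcases Nat.lt_succ_iff_lt_or_eq.1 (Nat.lt_succ_of_le h2) with h3 | rfl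
        · exact (hb r' h1 (by omega)).mono hkk'
        · exact hinc
      · omega
    · rintro s ⟨⟨x, y, hg, -⟩, k, P, hP, hS, hst, h2, hk, hb⟩ -
      refine (ends_output hg.n_eq hg.nn_eq h2 hk hst).mono le_rfl ?_
      rintro s' ⟨rfl, hs'⟩
      rw [turn_four] at hS
      refine ⟨⟨⟨P, hP, hS⟩, fun k ⟨P', hP', hS'⟩ => le_of_incBound hb hP' hS'⟩, ?_, P, hP, hS, hs'⟩
      simp only [lim]
      omega
    · nlinarith [Nat.zero_le (Nat.log 2 (n + 1) * (n + 1) ^ 4)]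
  · nlinarith [Nat.zero_le (Nat.log 2 (n + 1) * (n + 1) ^ 4)]

end

/-! ### Asymptotics -/

theorem isBigO_pow_succ (c k : ℕ) :
    (fun n : ℕ => ((c * (n + 1) ^ k : ℕ) : ℝ)) =O[atTop] fun n : ℕ => (n : ℝ) ^ k := by
  refine IsBigO.of_bound ((c : ℝ) * 2 ^ k) ?_
  filter_upwards [eventually_ge_atTop 1] with n hn
  have hn' : (1 : ℝ) ≤ n := by exact_mod_cast hn
  rw [Real.norm_of_nonneg (by positivity), Real.norm_of_nonneg (by positivity), mul_assoc,
    ← mul_pow]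
  push_cast
  gcongr
  linarith

theorem lim_le (n : ℕ) : 10 * (n * n) + 10 * n + 10 ≤ 10 * (n + 1) ^ 2 := by nlinarith

theorem isBigO_lim :
    (fun n : ℕ => ((10 * (n * n) + 10 * n + 10 : ℕ) : ℝ)) =O[atTop] fun n : ℕ => (n : ℝ) ^ 2 := by
  refine IsBigO.trans (IsBigO.of_bound 1 (Eventually.of_forall fun n => ?_)) (isBigO_pow_succ 10 2)
  rw [Real.norm_of_nonneg (by positivity), Real.norm_of_nonneg (by positivity), one_mul]
  exact_mod_cast lim_le n

theorem isBigO_one_logb : (fun _ : ℕ => (1 : ℝ)) =O[atTop] fun n : ℕ => Real.logb 2 n := by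
  refine IsBigO.of_bound 1 ?_
  filter_upwards [eventually_ge_atTop 2] with n hn
  have hn' : (2 : ℝ) ≤ n := by exact_mod_cast hn
  have : 1 ≤ Real.logb 2 n := by
    rw [Real.le_logb_iff_rpow_le (by norm_num) (by linarith)]
    simpa using hn'
  rw [norm_one, one_mul, Real.norm_of_nonneg (by linarith)]
  exact this

theorem isBigO_log_succ :
    (fun n : ℕ => ((Nat.log 2 (n + 1) + 3 : ℕ) : ℝ)) =O[atTop] fun n : ℕ => Real.logb 2 n := by
  refine IsBigO.of_bound 5 ?_
  filter_upwards [eventually_ge_atTop 2] with n hn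
  have hn' : (2 : ℝ) ≤ n := by exact_mod_cast hn
  have h1 : 1 ≤ Real.logb 2 n := by
    rw [Real.le_logb_iff_rpow_le (by norm_num) (by linarith)]
    simpa using hn'
  have h2 : (Nat.log 2 (n + 1) : ℝ) ≤ Real.logb 2 (2 * n) := by
    rw [Real.le_logb_iff_rpow_le (by norm_num) (by linarith), Real.rpow_natCast]
    have h3 : 2 ^ Nat.log 2 (n + 1) ≤ 2 * n :=
      (Nat.pow_log_le_self 2 (by omega)).trans (by omega)
    exact_mod_cast h3
  rw [Real.logb_mul (by norm_num) (by positivity), Real.logb_self_eq_one (by norm_num)] at h2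
  rw [Real.norm_of_nonneg (by positivity), Real.norm_of_nonneg (by linarith)]
  push_cast
  linarith

end GridChain

theorem mainTheorem10 :
    (∃ (p : GridChain.Prog) (T S W : ℕ → ℕ),
      (fun n => (T n : ℝ)) =O[atTop] (fun n : ℕ => (n : ℝ) ^ 4) ∧
      (fun n => (S n : ℝ)) =O[atTop] (fun n : ℕ => (n : ℝ) ^ 2) ∧
      (∃ c : ℕ, (fun n => (W n : ℝ)) =O[atTop] (fun n : ℕ => (n : ℝ) ^ c)) ∧
      GridChain.SolvesGrid p T S W GridChain.ReturnsMaxSize) ∧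
    (∃ (p : GridChain.Prog) (T S W : ℕ → ℕ),
      (fun n => (T n : ℝ)) =O[atTop] (fun n : ℕ => (n : ℝ) ^ 4 * Real.logb 2 n) ∧
      (fun n => (S n : ℝ)) =O[atTop] (fun n : ℕ => (n : ℝ) ^ 2 * Real.logb 2 n) ∧
      (∃ c : ℕ, (fun n => (W n : ℝ)) =O[atTop] (fun n : ℕ => (n : ℝ) ^ c)) ∧
      GridChain.SolvesGrid p T S W GridChain.ReturnsMaxChain) := by
  refine ⟨⟨GridChain.sizeProg, fun n => 10000 * (n + 1) ^ 4,
    fun n => 10 * (n * n) + 10 * n + 10, fun n => 10 * (n * n) + 10 * n + 10,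
    GridChain.isBigO_pow_succ 10000 4, GridChain.isBigO_lim, ⟨2, GridChain.isBigO_lim⟩,
    fun n hn X Y hX hY => GridChain.ends_sizeProg hn hX hY⟩, ⟨GridChain.chainProg,
    fun n => (Nat.log 2 (n + 1) + 3) * (20000 * (n + 1) ^ 4),
    fun n => 10 * (n * n) + 10 * n + 10, fun n => 10 * (n * n) + 10 * n + 10, ?_, ?_,
    ⟨2, GridChain.isBigO_lim⟩, fun n hn X Y hX hY => GridChain.ends_chainProg hn hX hY⟩⟩
  · have := (GridChain.isBigO_pow_succ 20000 4).mul GridChain.isBigO_log_succ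
    refine this.congr_left fun n => ?_
    push_cast
    ring
  -- The space used is already quadratic; the logarithm enters only through `1 = O(log n)`.
  · simpa using GridChain.isBigO_lim.mul GridChain.isBigO_one_logb
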